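/- Let $K\ge 1$, $\rho\in(0,1)$, $q\in[0,1]$, and let $f_0,f_1$ be probability densities with respect to a common $\sigma$-finite measure, with Kullback–Leibler divergence $D(f_1\|f_0)\in[0,\infty]$. There are $K$ independent data streams $(X_n^{(k)})_{n\ge1}$, $k=1,\dots,K$. Stream $k$ has a random change point $t^{(k)}$ with $P(t^{(k)}=m)=\rho(1-\rho)^{m-1}$, $m=1,2,\dots$, and given $t^{(k)}$ the observations $X_n^{(k)}$ are independent, with density $f_0$ for $n<t^{(k)}$ and density $f_1$ for $n\ge t^{(k)}$. Fix $\alpha\in(0,1)$. All streams are active at the beginning. At each time slot $n\ge1$, if $I$ is the set of active streams, one observes $X^{(k)}_n$ for $k\in s_n$, where $s_n\subseteq I$ consists of $\lceil q|I|\rceil$ active streams with the highest posterior probabilities $\pi_{n-1}^{(k)}$, ties being broken by any rule based on the data observed before slot $n$. Here $\pi_n^{(k)}=P(t^{(k)}\le n\mid\mathcal F_n)$ with $\mathcal F_n$ the $\sigma$-algebra generated by the data observed up to time slot $n$ (so $\pi_0^{(k)}=0$). Then changes are declared for some active streams, which become inactive: * S-MAP: with $Q_r=1-\frac{r\alpha}{K}$,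 sort the posterior probabilities of the active streams as $\pi_n^{(i(1))}\le\dots\le\pi_n^{(i(|I|))}$; if $\pi_n^{(i(l))}\ge Q_{K-l+1}$ for some $l$ and $l^*$ is the smallest such $l$, declare changes for $i(l^*),i(l^*+1),\dots,i(|I|)$. * IS-MAP: declare a change for every active stream with $\pi_n^{(k)}\ge 1-\alpha$. Let $T^{(k)}\in\{1,2,\dots\}\cup\{\infty\}$ be the time slot at which the change of stream $k$ is declared, and let $$\mathrm{ADD}=\frac1K\sum_{k=1}^K \mathrm E\big[\max\{0,T^{(k)}-t^{(k)}\}\big].$$ Then, with the other parameters fixed and with terms $o_\alpha(1)\to0$ as $\alpha\to0^+$, $$\mathrm{ADD}_{\text{S-MAP}}\ \ge\ \frac{|\log\alpha|}{D(f_1\|f_0)+|\log(1-\rho)|}(1+o_\alpha(1)),$$ $$\mathrm{ADD}_{\text{S-MAP}}\ \le\ \frac{\log K-\frac1K\log K!+|\log\alpha|}{|\log(1-\rho)|}(1+o_\alpha(1)),$$ $$\mathrm{ADD}_{\text{IS-MAP}}\ \ge\ \frac{|\log\alpha|}{D(f_1\|f_0)+|\log(1-\rho)|}(1+o_\alpha(1)),$$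 $$\mathrm{ADD}_{\text{IS-MAP}}\ \le\ \frac{|\log\alpha|}{|\log(1-\rho)|}(1+o_\alpha(1)),$$ where the lower bounds are read as $0$ if $D(f_1\|f_0)=\infty$. -/

import Mathlib

open MeasureTheory ProbabilityTheory Filter Topology
open scoped ENNReal

namespace ChangePoint

noncomputable section

variable {Ω E : Type*} {K : ℕ}

/-- The statistical model. There are `K` independent data streams. Stream `k` has the change point
`t k` and the observations `X 1 k, X 2 k, …` (the index `0` is never used). The change points are
geometric with parameter `ρ` on `{1, 2, …}` and, given `t k = m`, the observations `X n k` are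
independent with density `f₀` for `n < m` and density `f₁` for `m ≤ n`, with respect to `ν`. -/
structure IsModel [MeasurableSpace Ω] [MeasurableSpace E] (μ : Measure Ω) (ν : Measure E)
    (f₀ f₁ : E → ℝ≥0∞) (ρ : ℝ) (t : Fin K → Ω → ℕ) (X : ℕ → Fin K → Ω → E) : Prop where
  measurable_t : ∀ k, Measurable (t k)
  measurable_X : ∀ n k, Measurable (X n k)
  /-- the streams are independent of each other -/
  indep : iIndepFun (fun (k : Fin K) (ω : Ω) => (t k ω, fun n : ℕ => X (n + 1) k ω)) μ
  /-- the prior of each change point -/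
  prior : ∀ (k : Fin K) (m : ℕ), 1 ≤ m →
    μ {ω | t k ω = m} = ENNReal.ofReal (ρ * (1 - ρ) ^ (m - 1))
  /-- the law of the observations of a stream given its change point -/
  obs : ∀ (k : Fin K) (m : ℕ), 1 ≤ m → ∀ (N : ℕ) (B : ℕ → Set E), (∀ n, MeasurableSet (B n)) →
    μ {ω | t k ω = m ∧ ∀ n ∈ Finset.Icc 1 N, X n k ω ∈ B n} =
      μ {ω | t k ω = m} *
        ∏ n ∈ Finset.Icc 1 N, ν.withDensity (if n < m then f₀ else f₁) (B n)

/-- The `σ`-algebra of the data observed up to time slot `n`, when the set of streams that are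
monitored at time slot `m` is `s m`. -/
abbrev obsSigma [MeasurableSpace E] (X : ℕ → Fin K → Ω → E) (s : ℕ → Ω → Finset (Fin K)) (n : ℕ) :
    MeasurableSpace Ω :=
  MeasurableSpace.generateFrom
    {A | ∃ m ∈ Finset.Icc 1 n, ∃ (k : Fin K) (B : Set E), MeasurableSet B ∧
      A = {ω | k ∈ s m ω ∧ X m k ω ∈ B}}

/-- `S` consists of `⌈q |I|⌉` elements of `I` with the highest values of `p`
(ties may be broken in any way). -/
def IsTop (q : ℝ) (I : Finset (Fin K)) (p : Fin K → ℝ) (S : Finset (Fin K)) : Prop :=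
  S ⊆ I ∧ S.card = ⌈q * (I.card : ℝ)⌉₊ ∧ ∀ i ∈ S, ∀ j ∈ I \ S, p j ≤ p i

/-- The position, from `1` to `|I|`, of `k ∈ I` when the values `p j`, `j ∈ I`, are sorted in
ascending order (equal values are sorted by their index). -/
def rank (I : Finset (Fin K)) (p : Fin K → ℝ) (k : Fin K) : ℕ :=
  (I.filter fun j => p j < p k ∨ (p j = p k ∧ j ≤ k)).card

/-- The S-MAP threshold `Q_r = 1 - r α / K`. -/
def smapThreshold (K : ℕ) (α : ℝ) (r : ℕ) : ℝ := 1 - r * α / K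

/-- The streams that S-MAP declares when `I` is the active set and `p` is the vector of posterior
probabilities: those whose position is at least the smallest position `l` at which the
sorted posterior probability is at least `Q_{K-l+1}` (none, if there is no such `l`). -/
def smapDeclare (α : ℝ) (I : Finset (Fin K)) (p : Fin K → ℝ) : Finset (Fin K) :=
  I.filter fun k =>
    ∃ j ∈ I, smapThreshold K α (K - rank I p j + 1) ≤ p j ∧ rank I p j ≤ rank I p k

/-- The streams that IS-MAP declares: those whose posterior probability is at least `1 - α`. -/
def ismapDeclare (α : ℝ) (I : Finset (Fin K)) (p : Fin K → ℝ) : Finset (Fin K) :=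
  I.filter fun k => 1 - α ≤ p k

/-- The set of active streams after the declarations of time slot `n`, when `p n` is the vector of
posterior probabilities at time slot `n`. -/
def active (declare : Finset (Fin K) → (Fin K → ℝ) → Finset (Fin K)) (p : ℕ → Fin K → ℝ) :
    ℕ → Finset (Fin K)
  | 0 => Finset.univ
  | n + 1 => active declare p n \ declare (active declare p n) (p (n + 1))

/-- The time slot at which the change of stream `k` is declared, `⊤` if this never happens. -/
def stopTime (declare : Finset (Fin K) → (Fin K → ℝ) → Finset (Fin K)) (p : ℕ → Fin K → ℝ)
    (k : Fin K) : ℕ∞ :=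
  ⨅ (n : ℕ) (_ : k ∉ active declare p n), (n : ℕ∞)

/-- `s` and `π` are the monitored sets and the posterior probabilities of the sequential MAP
procedure with proportion `q` and declaration rule `declare`: the monitored sets are chosen from the
past observed data, `π n k` is (a version of) the conditional probability of `t k ≤ n` given the
data observed up to time slot `n`, and at every time slot the `⌈q |I|⌉` streams of the active set `I`
with the currently highest posterior probabilities are monitored. -/
structure IsProcedure [MeasurableSpace Ω] [MeasurableSpace E] (μ : Measure Ω)
    (t : Fin K → Ω → ℕ) (X : ℕ → Fin K → Ω → E) (q : ℝ)
    (declare : Finset (Fin K) → (Fin K → ℝ) → Finset (Fin K))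
    (s : ℕ → Ω → Finset (Fin K)) (π : ℕ → Fin K → Ω → ℝ) : Prop where
  predictable : ∀ (n : ℕ) (A : Finset (Fin K)),
    MeasurableSet[obsSigma X s n] {ω | s (n + 1) ω = A}
  posterior : ∀ (n : ℕ) (k : Fin K),
    π n k =ᵐ[μ] μ[({ω | t k ω ≤ n}.indicator fun _ => (1 : ℝ)) | obsSigma X s n]
  sample : ∀ n : ℕ, ∀ᵐ ω ∂μ,
    IsTop q (active declare (fun m k => π m k ω) n) (fun k => π n k ω) (s (n + 1) ω)

/-- The average detection delay `(1/K) ∑ₖ E[max(0, T k - t k)]`, where `T` are the declaration times;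
the subtraction is the truncated one of `ℝ≥0∞`. -/
def avgDelay [MeasurableSpace Ω] (μ : Measure Ω) (t : Fin K → Ω → ℕ)
    (declare : Finset (Fin K) → (Fin K → ℝ) → Finset (Fin K)) (π : ℕ → Fin K → Ω → ℝ) : ℝ≥0∞ :=
  (∑ k : Fin K, ∫⁻ ω, ((stopTime declare (fun m j => π m j ω) k : ℕ∞) : ℝ≥0∞)
    - (t k ω : ℝ≥0∞) ∂μ) / (K : ℝ≥0∞)

/-- The lower bound `|log α| / (D(f₁‖f₀) + |log (1 - ρ)|)`; it is `0` if the divergence is `∞`. -/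
def delayLower [MeasurableSpace E] (ν : Measure E) (f₀ f₁ : E → ℝ≥0∞) (ρ α : ℝ) : ℝ≥0∞ :=
  ENNReal.ofReal |Real.log α| /
    (InformationTheory.klDiv (ν.withDensity f₁) (ν.withDensity f₀) +
      ENNReal.ofReal |Real.log (1 - ρ)|)

end

end ChangePoint

/-! The bounds hold stream by stream. Fix a stream `k`, let `T` be its declaration time and let `Aₙ`
be the event that it is active after slot `n`, so that `E T = ∑ₙ P(Aₙ)`. Of the declaration rule
only `IsThresholdRule` matters: every active stream with posterior at least `1 - a` is declared, and
no stream with posterior below `1 - b` is. IS-MAP has `a = b = α`; S-MAP has `a = α / K`, `b = α`,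
because its thresholds lie between `1 - α` and `1 - α / K`.

Upper bound. The posterior probability of no change, `xₙ = P(t > n | ℱₙ)`, satisfies `E[xₙ₊₁ | ℱₙ] =
(1 - ρ) xₙ`, since the geometric prior is memoryless. By Jensen, `-log xₙ` gains at least `|log (1 -
ρ)|` per slot on average. As `xₙ ≥ a` while the stream is active, this potential cannot exceed `-log
a` before the exit. The overshoot at the exit is controlled by using a tangent line in place of the
logarithm, so `|log (1 - ρ)| E T ≤ |log a| + O(1)` (`sum_measureReal_le`,
`IsModel.lintegral_stopTime_le`).

Lower bound. Give the observer all other streams and every observation of stream `k`. The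
corresponding probability of no change `yₙ` (`noChange`) obeys the Bayes recursion, and convexity of
`klFun` shows that `-log yₙ` gains at most `D(f₁‖f₀) + |log (1 - ρ)|` per slot on average. A
declaration requires `xₙ ≤ α`; since `xₙ` is the projection of `yₙ` on coarser information, Jensen
gives an average of `-log yₙ` of at least `|log α|` at the exit. Hence `|log α| ≤ (D + |log (1 -
ρ)|) E T` (`le_mul_tsum_measure`, `IsModel.le_lintegral_stopTime`).

Finally `E T - E t ≤ E max(0, T - t) ≤ E T` with `E t < ∞`, and all additive constants, in
particular `log K - (log K!) / K`, are absorbed by the factor `1 + o(1)`. -/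

namespace ChangePoint

/-! ### One step of the Bayes filter. -/

section OneStep

open InformationTheory

/-- The new observation has density `w = (1 - v) ℓ + v` with respect to `P`, so the left side is the
mean of `-log` of the updated probability `v / w`. It equals `-log v + ∫ w log w`, and the last
integral is the divergence of a mixture of `ℓ P` and `P`, which by convexity is at most that of `ℓ
P`. -/
theorem lintegral_neg_log_mul_le {E : Type*} [MeasurableSpace E] (P : Measure E)
    [IsProbabilityMeasure P] {ℓ : E → ℝ≥0∞} (hℓ : Measurable ℓ) (hone : ∫⁻ e, ℓ e ∂P = 1)
    {v : ℝ} (hv : v ∈ Set.Ioc (0 : ℝ) 1) :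
    ∫⁻ e, ENNReal.ofReal (-Real.log (v / ((1 - v) * (ℓ e).toReal + v))) *
        ENNReal.ofReal ((1 - v) * (ℓ e).toReal + v) ∂P
      ≤ ENNReal.ofReal (-Real.log v) + ∫⁻ e, ENNReal.ofReal (klFun (ℓ e).toReal) ∂P := by
  obtain ⟨hv0, hv1⟩ := hv
  have hlt : ∀ᵐ e ∂P, ℓ e < ∞ := ae_lt_top hℓ (by simp [hone])
  have hw : ∫⁻ e, ENNReal.ofReal ((1 - v) * (ℓ e).toReal + v) ∂P = 1 := by
    have : ∀ᵐ e ∂P, ENNReal.ofReal ((1 - v) * (ℓ e).toReal + v)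
        = ENNReal.ofReal (1 - v) * ℓ e + ENNReal.ofReal v := by
      filter_upwards [hlt] with e he
      rw [ENNReal.ofReal_add (mul_nonneg (by linarith) ENNReal.toReal_nonneg) hv0.le,
        ENNReal.ofReal_mul (by linarith), ENNReal.ofReal_toReal he.ne]
    rw [lintegral_congr_ae this, lintegral_add_right _ measurable_const,
      lintegral_const_mul _ hℓ, hone, lintegral_const, measure_univ, mul_one, mul_one,
      ← ENNReal.ofReal_add (by linarith) hv0.le]
    simp
  have hmeas : Measurable fun e => ENNReal.ofReal ((1 - v) * (ℓ e).toReal + v) := by fun_prop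
  -- The summands `1` and `w` turn `w log w`, which may be negative, into `klFun w ≥ 0`, so that the
  -- comparison can live in `ℝ≥0∞`. Both integrate to one and cancel at the end.
  have key : ∀ e, ENNReal.ofReal (-Real.log (v / ((1 - v) * (ℓ e).toReal + v))) *
        ENNReal.ofReal ((1 - v) * (ℓ e).toReal + v) + 1 ≤
      ENNReal.ofReal (-Real.log v) * ENNReal.ofReal ((1 - v) * (ℓ e).toReal + v)
        + ENNReal.ofReal (klFun (ℓ e).toReal) + ENNReal.ofReal ((1 - v) * (ℓ e).toReal + v) := by
    intro e
    set L := (ℓ e).toReal with hL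
    have hL0 : 0 ≤ L := ENNReal.toReal_nonneg
    set w := (1 - v) * L + v with hwdef
    have hvw : v ≤ w := by nlinarith
    have hw0 : 0 < w := by linarith
    have hlogv : 0 ≤ -Real.log v := by linarith [Real.log_nonpos hv0.le hv1]
    have hlog : Real.log v ≤ Real.log w := Real.log_le_log hv0 hvw
    have hconv : klFun w ≤ (1 - v) * klFun L + v * klFun 1 := by
      have := convexOn_klFun.2 (Set.mem_Ici.2 hL0) (Set.mem_Ici.2 zero_le_one)
        (show 0 ≤ 1 - v by linarith) hv0.le (by ring)
      simpa [hwdef] using this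
    have hk : klFun w ≤ klFun L := by
      have := klFun_nonneg hL0
      rw [klFun_one] at hconv
      nlinarith
    rw [Real.log_div hv0.ne' hw0.ne', ← ENNReal.ofReal_mul (by linarith),
      ← ENNReal.ofReal_mul hlogv, ← ENNReal.ofReal_one,
      ← ENNReal.ofReal_add (by nlinarith) zero_le_one,
      ← ENNReal.ofReal_add (by positivity) (klFun_nonneg hL0),
      ← ENNReal.ofReal_add (add_nonneg (by positivity) (klFun_nonneg hL0)) hw0.le]
    apply ENNReal.ofReal_le_ofReal
    have : klFun w = w * Real.log w + 1 - w := rfl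
    nlinarith
  have h := lintegral_mono (μ := P) key
  rw [lintegral_add_right _ measurable_const, lintegral_add_right _ hmeas,
    lintegral_add_left (by fun_prop), lintegral_const_mul _ hmeas, hw] at h
  simpa using h

variable {Ω Ω' E : Type*} [MeasurableSpace Ω] [MeasurableSpace Ω'] [MeasurableSpace E]

theorem map_prodMk_eq_prod {μ : Measure Ω} [IsFiniteMeasure μ] {Y : Ω → Ω'} {X : Ω → E}
    (hY : Measurable Y) (hX : Measurable X) {P : Measure E} [IsProbabilityMeasure P]
    (h : ∀ A B, MeasurableSet A → MeasurableSet B →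
      μ (Y ⁻¹' A ∩ X ⁻¹' B) = μ (Y ⁻¹' A) * P B) :
    μ.map (fun ω => (Y ω, X ω)) = (μ.map Y).prod P := by
  symm
  apply Measure.prod_eq
  intro A B hA hB
  rw [Measure.map_apply (hY.prodMk hX) (hA.prod hB), Measure.map_apply hY hA, ← h A B hA hB]
  rfl

/-- The Bayesian update of a probability `v` of no change after an observation with likelihood
ratio `L`. -/
noncomputable def bayes (v L : ℝ) : ℝ := v / ((1 - v) * L + v)

theorem bayes_mem {v L : ℝ} (hv : v ∈ Set.Ioc (0 : ℝ) 1) (hL : 0 ≤ L) :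
    bayes v L ∈ Set.Ioc (0 : ℝ) 1 := by
  obtain ⟨h0, h1⟩ := hv
  have : v ≤ (1 - v) * L + v := by nlinarith
  exact ⟨div_pos h0 (by linarith), (div_le_one (by linarith)).2 this⟩

/-- The data of one step of the filtering problem: given the past `Y`, the event `T` has probability
`v Y`, and the new observation `X` has law `P` on `T` and law `ℓ P` off `T`. -/
structure IsStep (μ : Measure Ω) (P : Measure E) (ℓ : E → ℝ≥0∞) (Y : Ω → Ω') (X : Ω → E)
    (T : Set Ω) (v : Ω' → ℝ) : Prop where
  measurable_Y : Measurable Y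
  measurable_X : Measurable X
  measurableSet_T : MeasurableSet T
  measurable_v : Measurable v
  measurable_ℓ : Measurable ℓ
  lintegral_ℓ : ∫⁻ e, ℓ e ∂P = 1
  v_mem : ∀ y, v y ∈ Set.Ioc (0 : ℝ) 1
  before : ∀ A B, MeasurableSet A → MeasurableSet B →
    μ (Y ⁻¹' A ∩ X ⁻¹' B ∩ T) = μ (Y ⁻¹' A ∩ T) * P B
  after : ∀ A B, MeasurableSet A → MeasurableSet B →
    μ (Y ⁻¹' A ∩ X ⁻¹' B ∩ Tᶜ) = μ (Y ⁻¹' A ∩ Tᶜ) * P.withDensity ℓ B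
  prob : ∀ A, MeasurableSet A → μ (Y ⁻¹' A ∩ T) = ∫⁻ ω in Y ⁻¹' A, ENNReal.ofReal (v (Y ω)) ∂μ

variable {μ : Measure Ω} [IsProbabilityMeasure μ] {P : Measure E} [IsProbabilityMeasure P]
  {ℓ : E → ℝ≥0∞} {Y : Ω → Ω'} {X : Ω → E} {T : Set Ω} {v : Ω' → ℝ}

namespace IsStep

theorem map_restrict (h : IsStep μ P ℓ Y X T v) :
    (μ.restrict T).map (fun ω => (Y ω, X ω)) =
      ((μ.map Y).prod P).withDensity fun z => ENNReal.ofReal (v z.1) := by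
  have hv := h.measurable_v
  have hY := h.measurable_Y
  have h1 : (μ.restrict T).map Y = (μ.map Y).withDensity fun y => ENNReal.ofReal (v y) := by
    ext A hA
    rw [Measure.map_apply hY hA, Measure.restrict_apply (hY hA), h.prob A hA,
      withDensity_apply _ hA, setLIntegral_map hA (by fun_prop) hY]
  rw [map_prodMk_eq_prod (P := P) hY h.measurable_X, h1,
    prod_withDensity_left (by fun_prop)]
  intro A B hA hB
  rw [Measure.restrict_apply ((hY hA).inter (h.measurable_X hB)),
    Measure.restrict_apply (hY hA), h.before A B hA hB]

theorem map_restrict_compl (h : IsStep μ P ℓ Y X T v) :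
    (μ.restrict Tᶜ).map (fun ω => (Y ω, X ω)) =
      ((μ.map Y).prod P).withDensity fun z => ENNReal.ofReal (1 - v z.1) * ℓ z.2 := by
  have hv := h.measurable_v
  have hY := h.measurable_Y
  have hℓ := h.measurable_ℓ
  have : IsProbabilityMeasure (P.withDensity ℓ) :=
    ⟨by rw [withDensity_apply _ MeasurableSet.univ, Measure.restrict_univ, h.lintegral_ℓ]⟩
  have h1 : (μ.restrict Tᶜ).map Y = (μ.map Y).withDensity fun y => ENNReal.ofReal (1 - v y) := by
    ext A hA
    rw [Measure.map_apply hY hA, Measure.restrict_apply (hY hA),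
      withDensity_apply _ hA, setLIntegral_map hA (by fun_prop) hY]
    have hsum : μ (Y ⁻¹' A ∩ T) + μ (Y ⁻¹' A ∩ Tᶜ) = μ (Y ⁻¹' A) := by
      rw [← Set.sdiff_eq, measure_inter_add_sdiff _ h.measurableSet_T]
    have hint : ∫⁻ ω in Y ⁻¹' A, ENNReal.ofReal (v (Y ω)) ∂μ +
        ∫⁻ ω in Y ⁻¹' A, ENNReal.ofReal (1 - v (Y ω)) ∂μ = μ (Y ⁻¹' A) := by
      rw [← lintegral_add_left (by fun_prop), ← setLIntegral_one]
      refine lintegral_congr fun ω => ?_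
      rw [← ENNReal.ofReal_add (h.v_mem _).1.le (by linarith [(h.v_mem (Y ω)).2])]
      simp
    rw [← h.prob A hA, ← hsum] at hint
    exact ((ENNReal.add_right_inj (measure_ne_top _ _)).1 hint).symm
  rw [map_prodMk_eq_prod (P := P.withDensity ℓ) hY h.measurable_X, h1,
    prod_withDensity (by fun_prop) hℓ]
  intro A B hA hB
  rw [Measure.restrict_apply ((hY hA).inter (h.measurable_X hB)),
    Measure.restrict_apply (hY hA), h.after A B hA hB]

omit [IsProbabilityMeasure P] in
theorem ae_ℓ_lt_top (h : IsStep μ P ℓ Y X T v) : ∀ᵐ z ∂((μ.map Y).prod P), ℓ z.2 < ∞ := by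
  have hY := h.measurable_Y
  have : IsProbabilityMeasure (μ.map Y) := Measure.isProbabilityMeasure_map hY.aemeasurable
  have hlt : ∀ᵐ e ∂P, ℓ e < ∞ := ae_lt_top h.measurable_ℓ (by simp [h.lintegral_ℓ])
  exact Measure.quasiMeasurePreserving_snd.ae hlt

theorem map_eq (h : IsStep μ P ℓ Y X T v) :
    μ.map (fun ω => (Y ω, X ω)) = ((μ.map Y).prod P).withDensity
      fun z => ENNReal.ofReal ((1 - v z.1) * (ℓ z.2).toReal + v z.1) := by
  have hv := h.measurable_v
  have hℓ := h.measurable_ℓ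
  have hae : (fun z : Ω' × E => ENNReal.ofReal ((1 - v z.1) * (ℓ z.2).toReal + v z.1))
      =ᵐ[(μ.map Y).prod P]
      (fun z => ENNReal.ofReal (v z.1)) + fun z => ENNReal.ofReal (1 - v z.1) * ℓ z.2 := by
    filter_upwards [h.ae_ℓ_lt_top] with z hz
    have h1 : 0 ≤ 1 - v z.1 := by linarith [(h.v_mem z.1).2]
    rw [ENNReal.ofReal_add (mul_nonneg h1 ENNReal.toReal_nonneg) (h.v_mem _).1.le,
      ENNReal.ofReal_mul h1, ENNReal.ofReal_toReal hz.ne, add_comm]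
    rfl
  rw [withDensity_congr_ae hae, withDensity_add_left (by fun_prop), ← h.map_restrict,
    ← h.map_restrict_compl, ← Measure.map_add _ _ (h.measurable_Y.prodMk h.measurable_X),
    Measure.restrict_add_restrict_compl h.measurableSet_T]

omit [IsProbabilityMeasure μ] [IsProbabilityMeasure P] in
theorem measurable_bayes (h : IsStep μ P ℓ Y X T v) :
    Measurable fun z : Ω' × E => bayes (v z.1) (ℓ z.2).toReal := by
  have hv := h.measurable_v
  have hℓ := h.measurable_ℓ
  unfold bayes
  fun_prop

omit [IsProbabilityMeasure μ] [IsProbabilityMeasure P] in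
theorem bayes_pos (h : IsStep μ P ℓ Y X T v) (z : Ω' × E) :
    0 < (1 - v z.1) * (ℓ z.2).toReal + v z.1 := by
  have h1 : 0 ≤ 1 - v z.1 := by linarith [(h.v_mem z.1).2]
  have := (h.v_mem z.1).1
  have := mul_nonneg h1 (ENNReal.toReal_nonneg (a := ℓ z.2))
  linarith

/-- `bayes` computes the conditional probability of `T` given the past and the new observation. -/
theorem prob_bayes (h : IsStep μ P ℓ Y X T v) {A : Set (Ω' × E)} (hA : MeasurableSet A) :
    μ ((fun ω => (Y ω, X ω)) ⁻¹' A ∩ T) = ∫⁻ ω in (fun ω => (Y ω, X ω)) ⁻¹' A,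
      ENNReal.ofReal (bayes (v (Y ω)) (ℓ (X ω)).toReal) ∂μ := by
  have hv := h.measurable_v
  have hℓ := h.measurable_ℓ
  have hYX := h.measurable_Y.prodMk h.measurable_X
  have hb := h.measurable_bayes
  -- With respect to the product of the law of `Y` and `P`, the part on `T` has density `v` and the
  -- whole joint law has density `(1 - v) ℓ + v`; `bayes` is their quotient.
  rw [← Measure.restrict_apply (hYX hA), ← Measure.map_apply hYX hA, h.map_restrict,
    ← setLIntegral_map hA (f := fun z : Ω' × E => ENNReal.ofReal (bayes (v z.1) (ℓ z.2).toReal))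
      (by fun_prop) hYX, h.map_eq, withDensity_apply _ hA,
    setLIntegral_withDensity_eq_setLIntegral_mul _ (by fun_prop) (by fun_prop) hA]
  refine lintegral_congr fun z => ?_
  have hpos := h.bayes_pos z
  simp only [Pi.mul_apply]
  rw [← ENNReal.ofReal_mul hpos.le, bayes, mul_div_cancel₀ _ hpos.ne']

theorem lintegral_neg_log_bayes_le (h : IsStep μ P ℓ Y X T v) {A : Set Ω'}
    (hA : MeasurableSet A) :
    ∫⁻ ω in Y ⁻¹' A, ENNReal.ofReal (-Real.log (bayes (v (Y ω)) (ℓ (X ω)).toReal)) ∂μ ≤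
      ∫⁻ ω in Y ⁻¹' A, ENNReal.ofReal (-Real.log (v (Y ω))) ∂μ +
        (∫⁻ e, ENNReal.ofReal (klFun (ℓ e).toReal) ∂P) * μ (Y ⁻¹' A) := by
  have hv := h.measurable_v
  have hℓ := h.measurable_ℓ
  have hY := h.measurable_Y
  have hYX := h.measurable_Y.prodMk h.measurable_X
  have hb := h.measurable_bayes
  have : IsProbabilityMeasure (μ.map Y) := Measure.isProbabilityMeasure_map hY.aemeasurable
  have hpre : Y ⁻¹' A = (fun ω => (Y ω, X ω)) ⁻¹' (A ×ˢ Set.univ) := by ext; simp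
  calc _ = ∫⁻ z in A ×ˢ Set.univ, ENNReal.ofReal (-Real.log (bayes (v z.1) (ℓ z.2).toReal))
          ∂(μ.map fun ω => (Y ω, X ω)) := by
        rw [hpre, setLIntegral_map (hA.prod .univ) (by fun_prop) hYX]
    _ = ∫⁻ y in A, ∫⁻ e, ENNReal.ofReal (-Real.log (bayes (v y) (ℓ e).toReal)) *
          ENNReal.ofReal ((1 - v y) * (ℓ e).toReal + v y) ∂P ∂(μ.map Y) := by
        rw [h.map_eq, setLIntegral_withDensity_eq_setLIntegral_mul _ (by fun_prop) (by fun_prop)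
          (hA.prod .univ), setLIntegral_prod _ (by fun_prop)]
        simp only [Measure.restrict_univ, Pi.mul_apply, mul_comm]
    _ ≤ ∫⁻ y in A, (ENNReal.ofReal (-Real.log (v y)) +
          ∫⁻ e, ENNReal.ofReal (klFun (ℓ e).toReal) ∂P) ∂(μ.map Y) :=
        lintegral_mono fun y => lintegral_neg_log_mul_le P hℓ h.lintegral_ℓ (h.v_mem y)
    _ = _ := by
        rw [lintegral_add_right _ measurable_const, setLIntegral_const,
          Measure.map_apply hY hA, setLIntegral_map hA (by fun_prop) hY]

end IsStep

end OneStep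

/-! ### Potential arguments for the mean exit time. -/

section Stopping

variable {Ω : Type*} [m0 : MeasurableSpace Ω] {μ : Measure Ω} [IsProbabilityMeasure μ]

omit m0 in
theorem compl_union_sdiff {A B : Set Ω} (h : B ⊆ A) : Aᶜ ∪ A \ B = Bᶜ := by
  ext ω
  have := @h ω
  simp only [Set.mem_compl_iff, Set.mem_union, Set.mem_sdiff]
  tauto

omit m0 in
theorem disjoint_compl_sdiff (A B : Set Ω) : Disjoint Aᶜ (A \ B) :=
  Set.disjoint_left.2 fun _ h h' => h h'.1

/-- A lower bound for the expectation `∑ₙ μ (Aₙ)` of the time at which the sets `Aₙ` are left,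
in terms of a potential `z` that grows by at most `κ` per step and is at least `b` at the exit. -/
theorem le_mul_tsum_measure {A : ℕ → Set Ω} (hA : ∀ n, MeasurableSet (A n))
    (h0 : A 0 = Set.univ) (hanti : ∀ n, A (n + 1) ⊆ A n) {z : ℕ → Ω → ℝ≥0∞} {b κ : ℝ≥0∞}
    (hb : b ≠ ∞) (hκ : κ ≠ 0) (hz0 : ∀ ω, z 0 ω = 0)
    (hstep : ∀ n, ∫⁻ ω in A n, z (n + 1) ω ∂μ ≤ ∫⁻ ω in A n, z n ω ∂μ + κ * μ (A n))
    (hexit : ∀ n, b * μ (A n \ A (n + 1)) ≤ ∫⁻ ω in A n \ A (n + 1), z (n + 1) ω ∂μ) :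
    b ≤ κ * ∑' n, μ (A n) := by
  -- The left side is the mean of the potential stopped at the exit, with its exit value replaced by
  -- the lower bound `b`.
  have claim : ∀ N, ∫⁻ ω in A N, z N ω ∂μ + b * μ (A N)ᶜ ≤
      κ * ∑ n ∈ Finset.range N, μ (A n) := by
    intro N
    induction N with
    | zero => simp [h0, hz0]
    | succ N ih =>
      have hsplit : ∫⁻ ω in A N, z (N + 1) ω ∂μ = ∫⁻ ω in A (N + 1), z (N + 1) ω ∂μ +
          ∫⁻ ω in A N \ A (N + 1), z (N + 1) ω ∂μ := by
        rw [← lintegral_inter_add_sdiff _ (A N) (hA (N + 1)), Set.inter_eq_right.2 (hanti N)]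
      have hc : μ (A (N + 1))ᶜ = μ (A N)ᶜ + μ (A N \ A (N + 1)) := by
        rw [← compl_union_sdiff (hanti N), measure_union (disjoint_compl_sdiff _ _)
          ((hA N).diff (hA (N + 1)))]
      rw [Finset.sum_range_succ, mul_add, hc, mul_add]
      calc _ = (∫⁻ ω in A (N + 1), z (N + 1) ω ∂μ + b * μ (A N \ A (N + 1))) + b * μ (A N)ᶜ := by
            ring
        _ ≤ (∫⁻ ω in A N, z N ω ∂μ + κ * μ (A N)) + b * μ (A N)ᶜ := by
            refine add_le_add (le_trans ?_ (hstep N)) le_rfl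
            rw [hsplit]
            exact add_le_add le_rfl (hexit N)
        _ = (∫⁻ ω in A N, z N ω ∂μ + b * μ (A N)ᶜ) + κ * μ (A N) := by ring
        _ ≤ _ := by gcongr
  -- If the mean exit time is finite, then `μ (A N) → 0`, so in the limit all the mass pays `b`.
  by_cases hS : ∑' n, μ (A n) = ∞
  · simp [hS, ENNReal.mul_top hκ]
  have hlim : Tendsto (fun N => b * (1 - μ (A N))) atTop (𝓝 (b * (1 - 0))) :=
    ENNReal.Tendsto.const_mul (ENNReal.Tendsto.sub tendsto_const_nhds
      (ENNReal.tendsto_atTop_zero_of_tsum_ne_top hS) (Or.inl ENNReal.one_ne_top)) (Or.inr hb)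
  rw [tsub_zero, mul_one] at hlim
  refine le_of_tendsto' hlim fun N => ?_
  rw [← prob_compl_eq_one_sub (hA N)]
  calc _ ≤ _ := le_add_self
    _ ≤ _ := claim N
    _ ≤ _ := by gcongr; exact ENNReal.sum_le_tsum _

/-- An upper bound for the expectation of the time at which the sets `Aₙ` are left, when
`a ≤ xₙ` on `Aₙ` and the conditional expectations of the process `x` decay geometrically. -/
theorem sum_measureReal_le {ℱ : ℕ → MeasurableSpace Ω} (hℱ : ∀ n, ℱ n ≤ m0) {A : ℕ → Set Ω}
    (hA : ∀ n, MeasurableSet[ℱ n] (A n)) (hanti : ∀ n, A (n + 1) ⊆ A n)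
    {x : ℕ → Ω → ℝ} (hx : ∀ n, StronglyMeasurable[ℱ n] (x n))
    (h01 : ∀ n, ∀ᵐ ω ∂μ, x n ω ∈ Set.Icc (0 : ℝ) 1) {ρ a : ℝ} (hρ : ρ ∈ Set.Ioo (0 : ℝ) 1)
    (ha : a ∈ Set.Ioc (0 : ℝ) 1)
    (hstep : ∀ n, μ[x (n + 1)|ℱ n] =ᵐ[μ] fun ω => (1 - ρ) * x n ω)
    (hlow : ∀ n, ∀ᵐ ω ∂μ, ω ∈ A n → a ≤ x n ω) (N : ℕ) :
    -Real.log (1 - ρ) * ∑ n ∈ Finset.range N, μ.real (A n) ≤ 1 - Real.log ((1 - ρ) * a) := by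
  obtain ⟨hρ0, hρ1⟩ := hρ
  obtain ⟨ha0, ha1⟩ := ha
  have hρ' : 0 < 1 - ρ := by linarith
  have hAm : ∀ n, MeasurableSet (A n) := fun n => hℱ n _ (hA n)
  have hxm : ∀ n, Measurable (x n) := fun n => ((hx n).mono (hℱ n)).measurable
  have hxi : ∀ n, Integrable (x n) μ := fun n =>
    Integrable.of_bound (hxm n).aestronglyMeasurable 1 (by
      filter_upwards [h01 n] with ω h
      rw [Real.norm_eq_abs, abs_le]; constructor <;> linarith [h.1, h.2])
  -- `-log (x (n + 1))` is unbounded at the exit, where `x (n + 1)` may be tiny. Its tangent-line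
  -- minorant at `(1 - ρ) x n` stays below `M`, because `x n ≥ a` just before.
  set M := 1 - Real.log ((1 - ρ) * a) with hM
  have hlogi : ∀ n, IntegrableOn (fun ω => -Real.log (x n ω)) (A n) μ := fun n =>
    Measure.integrableOn_of_bounded (M := -Real.log a) (measure_ne_top _ _)
      (by fun_prop : Measurable fun ω => -Real.log (x n ω)).aestronglyMeasurable (by
        rw [ae_restrict_iff' (hAm n)]
        filter_upwards [hlow n, h01 n] with ω h h' hω
        have h1 := Real.log_le_log ha0 (h hω)
        have h2 := Real.log_nonpos h'.1 h'.2
        rw [Real.norm_eq_abs, abs_le]; constructor <;> linarith)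
  -- The ratio has conditional mean one on `A n`. The factor `ψ` can be pulled out of the
  -- conditional expectation: it is `ℱ n`-measurable, and bounded because `x n ≥ a` on `A n`.
  have hone : ∀ n, IntegrableOn (fun ω => x (n + 1) ω / ((1 - ρ) * x n ω)) (A n) μ ∧
      ∫ ω in A n, x (n + 1) ω / ((1 - ρ) * x n ω) ∂μ = μ.real (A n) := by
    intro n
    set ψ : Ω → ℝ := (A n).indicator fun ω => 1 / ((1 - ρ) * x n ω) with hψ
    have hψm : StronglyMeasurable[ℱ n] ψ := by
      refine StronglyMeasurable.indicator (Measurable.stronglyMeasurable ?_) (hA n)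
      have := (hx n).measurable
      fun_prop
    have hψb : ∀ᵐ ω ∂μ, ‖ψ ω‖ ≤ 1 / ((1 - ρ) * a) := by
      filter_upwards [hlow n] with ω h
      by_cases hω : ω ∈ A n
      · have := h hω
        have := ha0.trans_le this
        rw [hψ, Set.indicator_of_mem hω, Real.norm_of_nonneg (by positivity)]
        gcongr
      · rw [hψ, Set.indicator_of_notMem hω]
        simp only [norm_zero]
        positivity
    have hψx : Integrable (ψ * x (n + 1)) μ :=
      (hxi (n + 1)).bdd_mul (hψm.mono (hℱ n)).aestronglyMeasurable hψb
    have heq : ψ * x (n + 1) = (A n).indicator fun ω => x (n + 1) ω / ((1 - ρ) * x n ω) := by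
      ext ω
      by_cases hω : ω ∈ A n
      · simp only [Pi.mul_apply, hψ, Set.indicator_of_mem hω]; ring
      · simp [hψ, hω]
    refine ⟨?_, ?_⟩
    · rw [heq] at hψx
      exact (integrable_indicator_iff (hAm n)).1 hψx
    · rw [← integral_indicator (hAm n), ← heq, ← integral_condExp (hℱ n),
        integral_congr_ae (condExp_mul_of_stronglyMeasurable_left hψm hψx (hxi _)),
        ← integral_indicator_one (hAm n)]
      refine integral_congr_ae ?_
      filter_upwards [hstep n, hlow n] with ω h h'
      simp only [Pi.mul_apply, h]
      by_cases hω : ω ∈ A n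
      · have := ha0.trans_le (h' hω)
        simp only [hψ, Set.indicator_of_mem hω, Pi.one_apply]
        exact one_div_mul_cancel (by positivity)
      · simp [hψ, hω]
  have hM0 : 0 ≤ M := by
    have : Real.log ((1 - ρ) * a) ≤ 0 := Real.log_nonpos (by positivity) (by nlinarith)
    linarith
  have claim : ∀ N, -Real.log (1 - ρ) * ∑ n ∈ Finset.range N, μ.real (A n) ≤
      ∫ ω in A N, -Real.log (x N ω) ∂μ + M * μ.real (A N)ᶜ := by
    intro N
    induction N with
    | zero =>
      simp only [Finset.range_zero, Finset.sum_empty, mul_zero]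
      refine add_nonneg (setIntegral_nonneg_of_ae_restrict (ae_restrict_of_ae ?_)) (by positivity)
      filter_upwards [h01 0] with ω h
      have := Real.log_nonpos h.1 h.2
      simpa using this
    | succ N ih =>
      have hc : μ.real (A (N + 1))ᶜ = μ.real (A N)ᶜ + μ.real (A N \ A (N + 1)) := by
        rw [← compl_union_sdiff (hanti N), measureReal_union (disjoint_compl_sdiff _ _)
          ((hAm N).diff (hAm (N + 1)))]
      have hi : IntegrableOn (fun ω => -Real.log (x N ω) + (1 - Real.log (1 - ρ)) -
          x (N + 1) ω / ((1 - ρ) * x N ω)) (A N) μ :=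
        ((hlogi N).add (integrableOn_const (measure_ne_top _ _))).sub (hone N).1
      have hval : ∫ ω in A N, (-Real.log (x N ω) + (1 - Real.log (1 - ρ)) -
          x (N + 1) ω / ((1 - ρ) * x N ω)) ∂μ =
          ∫ ω in A N, -Real.log (x N ω) ∂μ + -Real.log (1 - ρ) * μ.real (A N) := by
        have hconst : IntegrableOn (fun _ => 1 - Real.log (1 - ρ)) (A N) μ :=
          integrableOn_const (measure_ne_top _ _)
        have hadd : IntegrableOn (fun ω => -Real.log (x N ω) + (1 - Real.log (1 - ρ))) (A N) μ :=
          (hlogi N).add hconst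
        rw [integral_sub hadd (hone N).1,
          integral_add (hlogi N) (integrableOn_const (measure_ne_top _ _)), (hone N).2,
          setIntegral_const, smul_eq_mul]
        ring
      have hsplit := integral_inter_add_sdiff (hAm (N + 1)) hi
      rw [Set.inter_eq_right.2 (hanti N), hval] at hsplit
      -- The tangent line of `-log` at `(1 - ρ) x N`, taken at `x (N + 1)`. Its integral over `A N`
      -- gives exactly the gain `-log (1 - ρ)`. It is bounded by `M` on the exiting part and by
      -- `-log (x (N + 1))` on the remaining part.
      have htan : ∀ᵐ ω ∂μ, ω ∈ A N → -Real.log (x N ω) + (1 - Real.log (1 - ρ)) -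
          x (N + 1) ω / ((1 - ρ) * x N ω) ≤ M ∧ (ω ∈ A (N + 1) →
          -Real.log (x N ω) + (1 - Real.log (1 - ρ)) -
          x (N + 1) ω / ((1 - ρ) * x N ω) ≤ -Real.log (x (N + 1) ω)) := by
        filter_upwards [hlow N, hlow (N + 1), h01 (N + 1)] with ω h h' h1 hω
        have hxa := h hω
        have hx0 : 0 < x N ω := by linarith
        have hl : Real.log a ≤ Real.log (x N ω) := Real.log_le_log ha0 hxa
        refine ⟨?_, fun hω' => ?_⟩
        · have : 0 ≤ x (N + 1) ω / ((1 - ρ) * x N ω) := div_nonneg h1.1 (by positivity)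
          rw [hM, Real.log_mul hρ'.ne' ha0.ne']
          linarith
        · have hy0 : 0 < x (N + 1) ω := by linarith [h' hω']
          have := Real.log_le_sub_one_of_pos (x := x (N + 1) ω / ((1 - ρ) * x N ω))
            (by positivity)
          rw [Real.log_div hy0.ne' (by positivity), Real.log_mul hρ'.ne' hx0.ne'] at this
          linarith
      have h1 : ∫ ω in A (N + 1), (-Real.log (x N ω) + (1 - Real.log (1 - ρ)) -
          x (N + 1) ω / ((1 - ρ) * x N ω)) ∂μ ≤ ∫ ω in A (N + 1), -Real.log (x (N + 1) ω) ∂μ := by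
        refine setIntegral_mono_on_ae (hi.mono_set (hanti N)) (hlogi _) (hAm _) ?_
        filter_upwards [htan] with ω h hω
        exact (h (hanti N hω)).2 hω
      have h2 : ∫ ω in A N \ A (N + 1), (-Real.log (x N ω) + (1 - Real.log (1 - ρ)) -
          x (N + 1) ω / ((1 - ρ) * x N ω)) ∂μ ≤ M * μ.real (A N \ A (N + 1)) := by
        calc _ ≤ ∫ ω in A N \ A (N + 1), M ∂μ := by
              refine setIntegral_mono_on_ae (hi.mono_set Set.sdiff_subset)
                (integrableOn_const (measure_ne_top _ _)) ((hAm _).diff (hAm _)) ?_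
              filter_upwards [htan] with ω h hω
              exact (h hω.1).1
          _ = _ := by rw [setIntegral_const, smul_eq_mul, mul_comm]
      rw [Finset.sum_range_succ, hc]
      linarith
  refine (claim N).trans ?_
  have hle : ∫ ω in A N, -Real.log (x N ω) ∂μ ≤ M * μ.real (A N) := by
    calc _ ≤ ∫ ω in A N, M ∂μ := by
          refine setIntegral_mono_on_ae (hlogi N) (integrableOn_const (measure_ne_top _ _))
            (hAm N) ?_
          filter_upwards [hlow N] with ω h hω
          have hl := Real.log_le_log ha0 (h hω)
          have := Real.log_nonpos hρ'.le (by linarith)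
          rw [hM, Real.log_mul hρ'.ne' ha0.ne']
          linarith
      _ = _ := by rw [setIntegral_const, smul_eq_mul, mul_comm]
  have hadd : μ.real (A N) + μ.real (A N)ᶜ = 1 := by
    rw [measureReal_add_measureReal_compl (hAm N), probReal_univ]
  nlinarith

end Stopping

end ChangePoint

namespace ChangePoint

/-! ### The information available before an observation. -/

section Past

variable {Ω E : Type*} {K : ℕ} [MeasurableSpace E]

/-- The change point and the observations of the stream `j`. -/
def streamData (t : Fin K → Ω → ℕ) (X : ℕ → Fin K → Ω → E) (j : Fin K) (ω : Ω) : ℕ × (ℕ → E) :=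
  (t j ω, fun n => X (n + 1) j ω)

/-- The `σ`-algebra of all streams but `k`. -/
abbrev otherSigma (t : Fin K → Ω → ℕ) (X : ℕ → Fin K → Ω → E) (k : Fin K) : MeasurableSpace Ω :=
  ⨆ j ∈ ({k}ᶜ : Set (Fin K)), MeasurableSpace.comap (streamData t X j) inferInstance

/-- The rectangles that generate `pastSigma`. -/
def pastRect (t : Fin K → Ω → ℕ) (X : ℕ → Fin K → Ω → E) (k : Fin K) (n : ℕ) : Set (Set Ω) :=
  {S | ∃ C, MeasurableSet[otherSigma t X k] C ∧ ∃ B : ℕ → Set E, (∀ i, MeasurableSet (B i)) ∧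
    S = C ∩ {ω | ∀ i ∈ Finset.Icc 1 n, X i k ω ∈ B i}}

/-- The `σ`-algebra of all streams but `k`, and of the first `n` observations of the stream `k`. -/
abbrev pastSigma (t : Fin K → Ω → ℕ) (X : ℕ → Fin K → Ω → E) (k : Fin K) (n : ℕ) :
    MeasurableSpace Ω :=
  MeasurableSpace.generateFrom (pastRect t X k n)

variable {t : Fin K → Ω → ℕ} {X : ℕ → Fin K → Ω → E}

theorem isPiSystem_pastRect (k : Fin K) (n : ℕ) : IsPiSystem (pastRect t X k n) := by
  rintro _ ⟨C, hC, B, hB, rfl⟩ _ ⟨C', hC', B', hB', rfl⟩ -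
  refine ⟨C ∩ C', hC.inter hC', fun i => B i ∩ B' i, fun i => (hB i).inter (hB' i), ?_⟩
  ext ω
  simp only [Set.mem_inter_iff, Set.mem_ofPred_eq, forall_and]
  tauto

theorem measurableSet_pastSigma_of_other {k : Fin K} {C : Set Ω}
    (hC : MeasurableSet[otherSigma t X k] C) (n : ℕ) : MeasurableSet[pastSigma t X k n] C :=
  MeasurableSpace.measurableSet_generateFrom ⟨C, hC, fun _ => Set.univ, fun _ => .univ, by simp⟩

theorem measurableSet_pastSigma_obs {k : Fin K} {n m : ℕ} (hm : m ∈ Finset.Icc 1 n) {B : Set E}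
    (hB : MeasurableSet B) : MeasurableSet[pastSigma t X k n] (X m k ⁻¹' B) := by
  refine MeasurableSpace.measurableSet_generateFrom ⟨Set.univ, .univ,
    fun i => if i = m then B else Set.univ, fun i => ?_, ?_⟩
  · dsimp only
    split_ifs
    exacts [hB, .univ]
  · ext ω
    simp only [Set.mem_preimage, Set.univ_inter, Set.mem_ofPred_eq]
    refine ⟨fun h i _ => ?_, fun h => by simpa using h m hm⟩
    split_ifs with hi
    · exact hi ▸ h
    · trivial

/-- Presents an event of the enlarged past as an event of the pair (old past, new observation), the
form that `IsStep.prob_bayes` handles. -/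
theorem pastSigma_succ_le (k : Fin K) (n : ℕ) : pastSigma t X k (n + 1) ≤
    MeasurableSpace.comap (fun ω => (ω, X (n + 1) k ω))
      (@Prod.instMeasurableSpace Ω E (pastSigma t X k n) _) := by
  refine MeasurableSpace.generateFrom_le ?_
  rintro _ ⟨C, hC, B, hB, rfl⟩
  refine ⟨(C ∩ {ω | ∀ i ∈ Finset.Icc 1 n, X i k ω ∈ B i}) ×ˢ B (n + 1), ?_, ?_⟩
  · let := pastSigma t X k n
    exact MeasurableSet.prod
      (MeasurableSpace.measurableSet_generateFrom ⟨C, hC, B, hB, rfl⟩) (hB _)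
  · ext ω
    simp only [Set.mk_preimage_prod, Set.mem_inter_iff, Set.mem_preimage, Set.mem_ofPred_eq,
      ← Finset.insert_Icc_right_eq_Icc_add_one (show 1 ≤ n + 1 by omega), Finset.forall_mem_insert]
    tauto

variable (t X) in
theorem pastSigma_mono (k : Fin K) : Monotone (pastSigma t X k) := by
  intro m n hmn
  refine MeasurableSpace.generateFrom_le ?_
  rintro _ ⟨C, hC, B, hB, rfl⟩
  refine MeasurableSpace.measurableSet_generateFrom ⟨C, hC,
    fun i => if i ≤ m then B i else Set.univ, fun i => ?_, ?_⟩
  · dsimp only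
    split_ifs
    exacts [hB i, .univ]
  · ext ω
    simp only [Set.mem_inter_iff, Set.mem_ofPred_eq, Finset.mem_Icc]
    refine and_congr_right fun _ => ⟨fun h i hi => ?_, fun h i hi => ?_⟩
    · split_ifs with hi'
      exacts [h i ⟨hi.1, hi'⟩, trivial]
    · have := h i ⟨hi.1, by omega⟩
      rwa [if_pos hi.2] at this

variable [mΩ : MeasurableSpace Ω]

theorem measurable_streamData (ht : ∀ k, Measurable (t k)) (hX : ∀ n k, Measurable (X n k))
    (j : Fin K) : Measurable (streamData t X j) :=
  (ht j).prodMk (measurable_pi_lambda _ fun n => hX (n + 1) j)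

theorem otherSigma_le (ht : ∀ k, Measurable (t k)) (hX : ∀ n k, Measurable (X n k))
    (k : Fin K) : otherSigma t X k ≤ mΩ :=
  iSup₂_le fun j _ => (measurable_streamData ht hX j).comap_le

theorem pastSigma_le (ht : ∀ k, Measurable (t k)) (hX : ∀ n k, Measurable (X n k))
    (k : Fin K) (n : ℕ) : pastSigma t X k n ≤ mΩ := by
  refine MeasurableSpace.generateFrom_le ?_
  rintro _ ⟨C, hC, B, hB, rfl⟩
  refine (otherSigma_le ht hX k _ hC).inter ?_
  have : {ω | ∀ i ∈ Finset.Icc 1 n, X i k ω ∈ B i} = ⋂ i ∈ Finset.Icc 1 n, X i k ⁻¹' B i := by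
    ext; simp
  rw [this]
  exact Finset.measurableSet_biInter _ fun i _ => hX i k (hB i)

omit mΩ in
theorem measurableSet_pastSigma_data {k j : Fin K} {n m : ℕ} (hm : m ∈ Finset.Icc 1 n) {B : Set E}
    (hB : MeasurableSet B) : MeasurableSet[pastSigma t X k n] (X m j ⁻¹' B) := by
  by_cases hj : j = k
  · subst hj
    exact measurableSet_pastSigma_obs hm hB
  · refine measurableSet_pastSigma_of_other ?_ n
    have hle : MeasurableSpace.comap (streamData t X j) inferInstance ≤ otherSigma t X k :=
      le_iSup₂_of_le (f := fun j (_ : j ∈ ({k}ᶜ : Set (Fin K))) =>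
        MeasurableSpace.comap (streamData t X j) inferInstance) j hj le_rfl
    refine hle _ ⟨{z | z.2 (m - 1) ∈ B}, ?_, ?_⟩
    · exact ((measurable_pi_apply (m - 1)).comp measurable_snd) hB
    · have : m - 1 + 1 = m := by have := Finset.mem_Icc.1 hm; omega
      ext ω
      simp [streamData, this]

omit mΩ in
theorem obsSigma_mono (s : ℕ → Ω → Finset (Fin K)) : Monotone (obsSigma X s) := by
  intro n n' h
  refine MeasurableSpace.generateFrom_mono ?_
  rintro A ⟨m, hm, hA⟩
  exact ⟨m, Finset.Icc_subset_Icc_right h hm, hA⟩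

omit mΩ in
-- Whether `j` is monitored at slot `m` is decided by the data up to slot `m - 1`, hence the strong
-- induction. This inclusion replaces the adaptive sampling by a fixed filtration, to which
-- independence of the streams applies.
theorem obsSigma_le_pastSigma {s : ℕ → Ω → Finset (Fin K)}
    (hs : ∀ (n : ℕ) (A : Finset (Fin K)), MeasurableSet[obsSigma X s n] {ω | s (n + 1) ω = A})
    (k : Fin K) (n : ℕ) : obsSigma X s n ≤ pastSigma t X k n := by
  induction n using Nat.strong_induction_on with
  | _ n ih =>
    refine MeasurableSpace.generateFrom_le ?_
    rintro _ ⟨m, hm, j, B, hB, rfl⟩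
    have hm' := Finset.mem_Icc.1 hm
    have hsm : MeasurableSet[pastSigma t X k n] {ω | j ∈ s m ω} := by
      have hmono := pastSigma_mono t X k (show m - 1 ≤ n by omega)
      have heq : {ω | j ∈ s m ω} = ⋃ A ∈ Finset.univ.filter fun A : Finset (Fin K) => j ∈ A,
          {ω | s m ω = A} := by
        ext ω; simp
      rw [heq]
      refine Finset.measurableSet_biUnion _ fun A _ => ?_
      have h1 := hs (m - 1) A
      rw [show m - 1 + 1 = m by omega] at h1
      exact hmono _ (ih (m - 1) (by omega) _ h1)
    exact hsm.inter (measurableSet_pastSigma_data hm hB)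

end Past

/-! ### The law of a change point and of the next observation, given the past. -/

namespace IsModel

variable {Ω E : Type*} {K : ℕ} [mΩ : MeasurableSpace Ω] [MeasurableSpace E] {μ : Measure Ω}
  [IsProbabilityMeasure μ] {ν : Measure E} {f₀ f₁ : E → ℝ≥0∞} {ρ : ℝ}
  {t : Fin K → Ω → ℕ} {X : ℕ → Fin K → Ω → E}

omit [IsProbabilityMeasure μ] in
theorem pastSigma_le (h : IsModel μ ν f₀ f₁ ρ t X) (k : Fin K) (n : ℕ) :
    pastSigma t X k n ≤ mΩ :=
  ChangePoint.pastSigma_le h.measurable_t h.measurable_X k n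

omit [IsProbabilityMeasure μ] in
theorem measure_eq_tsum (h : IsModel μ ν f₀ f₁ ρ t X) (k : Fin K) (S : Set Ω) :
    μ S = ∑' m : ℕ, μ (S ∩ {ω | t k ω = m}) := by
  have ht : ∀ m : ℕ, MeasurableSet {ω | t k ω = m} := fun m => h.measurable_t k (.singleton m)
  have hU : ⋃ m : ℕ, {ω | t k ω = m} = Set.univ := by ext; simp
  have hd : Pairwise (Function.onFun Disjoint fun m : ℕ => {ω | t k ω = m}) := fun m n hmn =>
    Set.disjoint_left.2 fun ω (h1 : t k ω = m) (h2 : t k ω = n) => hmn (h1.symm.trans h2)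
  have := measure_iUnion (μ := μ.restrict S) hd ht
  rw [hU, Measure.restrict_apply_univ] at this
  rw [this]
  exact tsum_congr fun m => by rw [Measure.restrict_apply (ht m), Set.inter_comm]

theorem measure_eq_zero (h : IsModel μ ν f₀ f₁ ρ t X) (hρ : ρ ∈ Set.Ioo (0 : ℝ) 1) (k : Fin K) :
    μ {ω | t k ω = 0} = 0 := by
  have h1 := h.measure_eq_tsum k Set.univ
  have h2 : ∑' m : ℕ, ENNReal.ofReal (ρ * (1 - ρ) ^ m) = 1 := by
    rw [← ENNReal.ofReal_tsum_of_nonneg]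
    · rw [tsum_mul_left, tsum_geometric_of_lt_one (by linarith [hρ.2]) (by linarith [hρ.1])]
      have := hρ.1.ne'
      simp [this]
    · intro n
      have h1 : 0 ≤ 1 - ρ := by linarith [hρ.2]
      have h2 := hρ.1.le
      positivity
    · exact (summable_geometric_of_lt_one (by linarith [hρ.2]) (by linarith [hρ.1])).mul_left _
  rw [measure_univ, tsum_eq_zero_add' ENNReal.summable] at h1
  simp only [Set.univ_inter] at h1
  rw [tsum_congr fun m => h.prior k (m + 1) (by omega)] at h1
  simp only [Nat.add_sub_cancel] at h1
  rw [h2] at h1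
  have h3 : μ {ω | t k ω = 0} + 1 = 0 + 1 := by rw [← h1, zero_add]
  exact (ENNReal.add_left_inj ENNReal.one_ne_top).1 h3

omit [IsProbabilityMeasure μ] in
theorem measure_inter_rect (h : IsModel μ ν f₀ f₁ ρ t X) {k : Fin K} {C : Set Ω}
    (hC : MeasurableSet[otherSigma t X k] C) {m : ℕ} (hm : 1 ≤ m) (N : ℕ) {B : ℕ → Set E}
    (hB : ∀ n, MeasurableSet (B n)) :
    μ (C ∩ {ω | t k ω = m ∧ ∀ n ∈ Finset.Icc 1 N, X n k ω ∈ B n}) =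
      μ C * (μ {ω | t k ω = m} *
        ∏ n ∈ Finset.Icc 1 N, ν.withDensity (if n < m then f₀ else f₁) (B n)) := by
  rw [← h.obs k m hm N B hB]
  have hind : Indep (otherSigma t X k)
      (⨆ j ∈ ({k} : Set (Fin K)), MeasurableSpace.comap (streamData t X j) inferInstance) μ :=
    indep_iSup_of_disjoint
      (fun j => (measurable_streamData h.measurable_t h.measurable_X j).comap_le)
      h.indep.iIndep (Set.disjoint_left.2 fun _ h h' => h h')
  refine (Indep_iff _ _ _).1 hind _ _ hC ?_
  rw [iSup_singleton]
  refine ⟨{z | z.1 = m ∧ ∀ n ∈ Finset.Icc 1 N, z.2 (n - 1) ∈ B n}, ?_, ?_⟩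
  · have : {z : ℕ × (ℕ → E) | z.1 = m ∧ ∀ n ∈ Finset.Icc 1 N, z.2 (n - 1) ∈ B n} =
        Prod.fst ⁻¹' {m} ∩ ⋂ n ∈ Finset.Icc 1 N, (fun z : ℕ × (ℕ → E) => z.2 (n - 1)) ⁻¹' B n := by
      ext; simp
    rw [this]
    refine (measurable_fst (.singleton m)).inter (Finset.measurableSet_biInter _ fun n _ => ?_)
    exact ((measurable_pi_apply (n - 1)).comp measurable_snd) (hB n)
  · ext ω
    simp only [streamData, Set.mem_preimage, Set.mem_ofPred_eq]
    refine and_congr_right fun _ => forall₂_congr fun n hn => ?_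
    rw [show n - 1 + 1 = n by have := Finset.mem_Icc.1 hn; omega]

/-- Given the change point, the next observation is independent of the past. -/
theorem measure_fiber_inter_obs (h : IsModel μ ν f₀ f₁ ρ t X) {k : Fin K} {n : ℕ} {A : Set Ω}
    (hA : MeasurableSet[pastSigma t X k n] A) {m : ℕ} (hm : 1 ≤ m) {B : Set E}
    (hB : MeasurableSet B) :
    μ (A ∩ ({ω | t k ω = m} ∩ X (n + 1) k ⁻¹' B)) =
      ν.withDensity (if n + 1 < m then f₀ else f₁) B * μ (A ∩ {ω | t k ω = m}) := by
  have ht : MeasurableSet {ω | t k ω = m} := h.measurable_t k (.singleton m)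
  have hXB : MeasurableSet (X (n + 1) k ⁻¹' B) := h.measurable_X _ _ hB
  have key : ∀ S ∈ pastRect t X k n, μ (S ∩ ({ω | t k ω = m} ∩ X (n + 1) k ⁻¹' B)) =
      ν.withDensity (if n + 1 < m then f₀ else f₁) B * μ (S ∩ {ω | t k ω = m}) := by
    rintro _ ⟨C, hC, D, hD, rfl⟩
    have h1 : C ∩ {ω | ∀ i ∈ Finset.Icc 1 n, X i k ω ∈ D i} ∩
        ({ω | t k ω = m} ∩ X (n + 1) k ⁻¹' B) = C ∩ {ω | t k ω = m ∧
          ∀ i ∈ Finset.Icc 1 (n + 1), X i k ω ∈ Function.update D (n + 1) B i} := by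
      ext ω
      have h2 : (∀ i ∈ Finset.Icc 1 n, X i k ω ∈ Function.update D (n + 1) B i) ↔
          ∀ i ∈ Finset.Icc 1 n, X i k ω ∈ D i := by
        refine forall₂_congr fun i hi => ?_
        rw [Function.update_of_ne (by have := Finset.mem_Icc.1 hi; omega)]
      simp only [Set.mem_inter_iff, Set.mem_ofPred_eq, Set.mem_preimage,
        ← Finset.insert_Icc_right_eq_Icc_add_one (show 1 ≤ n + 1 by omega),
        Finset.forall_mem_insert, Function.update_self, h2]
      tauto
    have h3 : C ∩ {ω | ∀ i ∈ Finset.Icc 1 n, X i k ω ∈ D i} ∩ {ω | t k ω = m} =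
        C ∩ {ω | t k ω = m ∧ ∀ i ∈ Finset.Icc 1 n, X i k ω ∈ D i} := by
      ext ω
      simp only [Set.mem_inter_iff, Set.mem_ofPred_eq]
      tauto
    have hD' : ∀ i, MeasurableSet (Function.update D (n + 1) B i) := by
      intro i
      by_cases hi : i = n + 1
      · subst hi; simpa using hB
      · simpa [hi] using hD i
    rw [h1, h3, h.measure_inter_rect hC hm _ hD', h.measure_inter_rect hC hm _ hD,
      Finset.prod_Icc_succ_top (by omega), Function.update_self,
      Finset.prod_congr rfl fun i hi => by
        rw [Function.update_of_ne (show i ≠ n + 1 by have := Finset.mem_Icc.1 hi; omega)]]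
    ring
  have huniv : Set.univ ∈ pastRect t X k n :=
    ⟨Set.univ, .univ, fun _ => Set.univ, fun _ => .univ, by simp⟩
  have hm1 : pastSigma t X k n ≤ mΩ := h.pastSigma_le k n
  -- As functions of the past event, both sides are finite measures that agree on the π-system of
  -- rectangles.
  have := ext_on_measurableSpace_of_generate_finite mΩ
    (μ := μ.restrict ({ω | t k ω = m} ∩ X (n + 1) k ⁻¹' B))
    (ν := ν.withDensity (if n + 1 < m then f₀ else f₁) B • μ.restrict {ω | t k ω = m})
    (pastRect t X k n) (fun S hS => by
      rw [Measure.restrict_apply' (ht.inter hXB), Measure.smul_apply,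
        Measure.restrict_apply' ht, smul_eq_mul, key S hS]) hm1 rfl (isPiSystem_pastRect k n)
    (by rw [Measure.restrict_apply' (ht.inter hXB), Measure.smul_apply,
        Measure.restrict_apply' ht, smul_eq_mul, key _ huniv]) hA
  rwa [Measure.restrict_apply' (ht.inter hXB), Measure.smul_apply,
        Measure.restrict_apply' ht, smul_eq_mul] at this

/-- For a change point beyond `n`, the first `n` observations all have density `f₀`, so passing from
`m` to `m + 1` only changes the prior weight, by the factor `1 - ρ`. -/
theorem measure_fiber_succ (h : IsModel μ ν f₀ f₁ ρ t X) (hρ : ρ ∈ Set.Ioo (0 : ℝ) 1) {k : Fin K}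
    {n : ℕ} {A : Set Ω} (hA : MeasurableSet[pastSigma t X k n] A) {m : ℕ} (hm : n < m) :
    μ (A ∩ {ω | t k ω = m + 1}) = ENNReal.ofReal (1 - ρ) * μ (A ∩ {ω | t k ω = m}) := by
  have ht : ∀ m : ℕ, MeasurableSet {ω | t k ω = m} := fun m => h.measurable_t k (.singleton m)
  have key : ∀ S ∈ pastRect t X k n,
      μ (S ∩ {ω | t k ω = m + 1}) = ENNReal.ofReal (1 - ρ) * μ (S ∩ {ω | t k ω = m}) := by
    rintro _ ⟨C, hC, D, hD, rfl⟩
    have h3 : ∀ m, C ∩ {ω | ∀ i ∈ Finset.Icc 1 n, X i k ω ∈ D i} ∩ {ω | t k ω = m} =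
        C ∩ {ω | t k ω = m ∧ ∀ i ∈ Finset.Icc 1 n, X i k ω ∈ D i} := by
      intro m
      ext ω
      simp only [Set.mem_inter_iff, Set.mem_ofPred_eq]
      tauto
    have h4 : μ {ω | t k ω = m + 1} = ENNReal.ofReal (1 - ρ) * μ {ω | t k ω = m} := by
      rw [h.prior k m (by omega), h.prior k (m + 1) (by omega),
        ← ENNReal.ofReal_mul (by linarith [hρ.2])]
      congr 1
      obtain ⟨m, rfl⟩ := Nat.exists_eq_add_of_lt hm
      simp only [Nat.add_sub_cancel]
      ring
    have h5 : ∏ i ∈ Finset.Icc 1 n, ν.withDensity (if i < m + 1 then f₀ else f₁) (D i) =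
        ∏ i ∈ Finset.Icc 1 n, ν.withDensity (if i < m then f₀ else f₁) (D i) := by
      refine Finset.prod_congr rfl fun i hi => ?_
      have := Finset.mem_Icc.1 hi
      rw [if_pos (by omega), if_pos (by omega)]
    rw [h3, h3, h.measure_inter_rect hC (by omega) _ hD, h.measure_inter_rect hC (by omega) _ hD,
      h4, h5]
    ring
  have huniv : Set.univ ∈ pastRect t X k n :=
    ⟨Set.univ, .univ, fun _ => Set.univ, fun _ => .univ, by simp⟩
  have := ext_on_measurableSpace_of_generate_finite mΩ
    (μ := μ.restrict {ω | t k ω = m + 1})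
    (ν := ENNReal.ofReal (1 - ρ) • μ.restrict {ω | t k ω = m})
    (pastRect t X k n) (fun S hS => by
      rw [Measure.restrict_apply' (ht _), Measure.smul_apply,
        Measure.restrict_apply' (ht _), smul_eq_mul, key S hS]) (h.pastSigma_le k n) rfl
    (isPiSystem_pastRect k n)
    (by rw [Measure.restrict_apply' (ht _), Measure.smul_apply,
        Measure.restrict_apply' (ht _), smul_eq_mul, key _ huniv]) hA
  rwa [Measure.restrict_apply' (ht _), Measure.smul_apply,
        Measure.restrict_apply' (ht _), smul_eq_mul] at this

theorem measure_inter_obs (h : IsModel μ ν f₀ f₁ ρ t X) (hρ : ρ ∈ Set.Ioo (0 : ℝ) 1) {k : Fin K}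
    {n : ℕ} {A : Set Ω} (hA : MeasurableSet[pastSigma t X k n] A) {B : Set E}
    (hB : MeasurableSet B) {V : Set ℕ} {f : E → ℝ≥0∞}
    (hV : ∀ m ∈ V, (if n + 1 < m then f₀ else f₁) = f) :
    μ (A ∩ X (n + 1) k ⁻¹' B ∩ t k ⁻¹' V) = μ (A ∩ t k ⁻¹' V) * ν.withDensity f B := by
  rw [h.measure_eq_tsum k, h.measure_eq_tsum k (A ∩ t k ⁻¹' V), ← ENNReal.tsum_mul_right]
  refine tsum_congr fun m => ?_
  rcases Nat.eq_zero_or_pos m with rfl | hm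
  · rw [measure_mono_null Set.inter_subset_right (h.measure_eq_zero hρ k),
      measure_mono_null Set.inter_subset_right (h.measure_eq_zero hρ k), zero_mul]
  by_cases hmV : m ∈ V
  · rw [← hV m hmV]
    have h1 : A ∩ X (n + 1) k ⁻¹' B ∩ t k ⁻¹' V ∩ {ω | t k ω = m} =
        A ∩ ({ω | t k ω = m} ∩ X (n + 1) k ⁻¹' B) := by
      ext ω
      simp only [Set.mem_inter_iff, Set.mem_preimage, Set.mem_ofPred_eq]
      constructor
      · tauto
      · rintro ⟨a, rfl, c⟩
        exact ⟨⟨⟨a, c⟩, hmV⟩, rfl⟩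
    have h2 : A ∩ t k ⁻¹' V ∩ {ω | t k ω = m} = A ∩ {ω | t k ω = m} := by
      ext ω
      simp only [Set.mem_inter_iff, Set.mem_preimage, Set.mem_ofPred_eq]
      constructor
      · tauto
      · rintro ⟨a, rfl⟩
        exact ⟨⟨a, hmV⟩, rfl⟩
    rw [h1, h2, h.measure_fiber_inter_obs hA hm hB, mul_comm]
  · have h0 : ∀ S : Set Ω, S ∩ t k ⁻¹' V ∩ {ω | t k ω = m} = ∅ := by
      intro S
      ext ω
      simp only [Set.mem_inter_iff, Set.mem_preimage, Set.mem_ofPred_eq, Set.mem_empty_iff_false,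
        iff_false]
      rintro ⟨⟨-, hV⟩, rfl⟩
      exact hmV hV
    rw [h0, h0, measure_empty, zero_mul]

/-- The prior is memoryless even conditionally on the past: sum `measure_fiber_succ` over `m > n`.
Both bounds get their term `|log (1 - ρ)|` from here. -/
theorem measure_inter_lt_succ (h : IsModel μ ν f₀ f₁ ρ t X) (hρ : ρ ∈ Set.Ioo (0 : ℝ) 1)
    {k : Fin K} {n : ℕ} {A : Set Ω} (hA : MeasurableSet[pastSigma t X k n] A) :
    μ (A ∩ {ω | n + 1 < t k ω}) = ENNReal.ofReal (1 - ρ) * μ (A ∩ {ω | n < t k ω}) := by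
  rw [h.measure_eq_tsum k, h.measure_eq_tsum k (A ∩ {ω | n < t k ω}), ← ENNReal.tsum_mul_left,
    tsum_eq_zero_add' ENNReal.summable,
    measure_mono_null Set.inter_subset_right (h.measure_eq_zero hρ k), zero_add]
  refine tsum_congr fun m => ?_
  have hset : ∀ n m, A ∩ {ω | n < t k ω} ∩ {ω | t k ω = m} =
      if n < m then A ∩ {ω | t k ω = m} else ∅ := by
    intro n m
    ext ω
    split_ifs with hnm
    · simp only [Set.mem_inter_iff, Set.mem_ofPred_eq]
      constructor
      · tauto
      · rintro ⟨a, rfl⟩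
        exact ⟨⟨a, hnm⟩, rfl⟩
    · simp only [Set.mem_inter_iff, Set.mem_ofPred_eq, Set.mem_empty_iff_false, iff_false]
      rintro ⟨⟨-, hV⟩, rfl⟩
      exact hnm hV
  rw [hset, hset]
  by_cases hnm : n < m
  · rw [if_pos (by omega), if_pos hnm, h.measure_fiber_succ hρ hA hnm]
  · rw [if_neg (by omega), if_neg hnm, measure_empty, mul_zero]

theorem lintegral_changePoint_ne_top (h : IsModel μ ν f₀ f₁ ρ t X) (hρ : ρ ∈ Set.Ioo (0 : ℝ) 1)
    (k : Fin K) : ∫⁻ ω, (t k ω : ℝ≥0∞) ∂μ ≠ ∞ := by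
  have hm : ∀ n, MeasurableSet {ω | n < t k ω} := fun n => h.measurable_t k measurableSet_Ioi
  have hpt : ∀ ω, (t k ω : ℝ≥0∞) = ∑' n : ℕ, {ω | n < t k ω}.indicator 1 ω := by
    intro ω
    rw [tsum_eq_sum (s := Finset.range (t k ω)) fun n hn => by simpa using hn,
      Finset.sum_congr rfl fun n hn => Set.indicator_of_mem
        (show ω ∈ {ω | n < t k ω} from Finset.mem_range.1 hn) _]
    simp
  have hle : ∀ n, μ {ω | n < t k ω} ≤ ENNReal.ofReal (1 - ρ) ^ n := by
    intro n
    induction n with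
    | zero => simpa using prob_le_one
    | succ n ih =>
      have := h.measure_inter_lt_succ hρ (k := k) (n := n) (A := Set.univ) .univ
      rw [Set.univ_inter, Set.univ_inter] at this
      rw [this, pow_succ']
      gcongr
  simp_rw [hpt]
  rw [lintegral_tsum fun n => (measurable_one.indicator (hm n)).aemeasurable]
  simp_rw [lintegral_indicator_one (hm _)]
  refine ne_top_of_le_ne_top ?_ (ENNReal.tsum_le_tsum hle)
  rw [ENNReal.tsum_geometric]
  refine ENNReal.inv_ne_top.2 (tsub_pos_of_lt ?_).ne'
  rw [← ENNReal.ofReal_one]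
  exact (ENNReal.ofReal_lt_ofReal_iff one_pos).2 (by linarith [hρ.1])

end IsModel

/-! ### The filter of an observer who sees the whole stream. -/

/-- The conditional probability that the stream `k` has not changed up to time `n`, given its first
`n` observations. -/
noncomputable def noChange {Ω E : Type*} {K : ℕ} (ρ : ℝ) (ℓ : E → ℝ≥0∞) (X : ℕ → Fin K → Ω → E)
    (k : Fin K) : ℕ → Ω → ℝ
  | 0, _ => 1
  | n + 1, ω => bayes ((1 - ρ) * noChange ρ ℓ X k n ω) (ℓ (X (n + 1) k ω)).toReal

theorem noChange_mem {Ω E : Type*} {K : ℕ} {ρ : ℝ} {X : ℕ → Fin K → Ω → E}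
    (hρ : ρ ∈ Set.Ioo (0 : ℝ) 1) (ℓ : E → ℝ≥0∞) (k : Fin K) (n : ℕ) (ω : Ω) :
    noChange ρ ℓ X k n ω ∈ Set.Ioc (0 : ℝ) 1 := by
  induction n with
  | zero => exact ⟨one_pos, le_rfl⟩
  | succ n ih =>
    have h1 : 0 < 1 - ρ := by linarith [hρ.2]
    exact bayes_mem ⟨mul_pos h1 ih.1, by nlinarith [ih.1, ih.2, hρ.1]⟩ ENNReal.toReal_nonneg

namespace IsModel

open InformationTheory

variable {Ω E : Type*} {K : ℕ} [mΩ : MeasurableSpace Ω] [MeasurableSpace E] {μ : Measure Ω}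
  [IsProbabilityMeasure μ] {ν : Measure E} {f₀ f₁ : E → ℝ≥0∞} {ρ : ℝ}
  {t : Fin K → Ω → ℕ} {X : ℕ → Fin K → Ω → E} {ℓ : E → ℝ≥0∞}

/-- Before slot `n + 1` is observed, the probability of no change up to that slot is `(1 - ρ)` times
the current one. The past is encoded as the identity map into `Ω` with the coarser `σ`-algebra
`pastSigma t X k n`. -/
theorem isStep (h : IsModel μ ν f₀ f₁ ρ t X) (hρ : ρ ∈ Set.Ioo (0 : ℝ) 1)
    [IsProbabilityMeasure (ν.withDensity f₁)]
    (hℓ : Measurable ℓ) (hℓf : (ν.withDensity f₀).withDensity ℓ = ν.withDensity f₁) {k : Fin K}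
    {n : ℕ} (hmeas : Measurable[pastSigma t X k n] (noChange ρ ℓ X k n))
    (hprob : ∀ A, MeasurableSet[pastSigma t X k n] A →
      μ (A ∩ {ω | n < t k ω}) = ∫⁻ ω in A, ENNReal.ofReal (noChange ρ ℓ X k n ω) ∂μ) :
    @IsStep Ω Ω E _ (pastSigma t X k n) _ μ (ν.withDensity f₀) ℓ id (X (n + 1) k)
      {ω | n + 1 < t k ω} (fun ω => (1 - ρ) * noChange ρ ℓ X k n ω) := by
  have h1 : 0 < 1 - ρ := by linarith [hρ.2]
  refine @IsStep.mk Ω Ω E _ (pastSigma t X k n) _ μ (ν.withDensity f₀) ℓ id (X (n + 1) k)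
      {ω | n + 1 < t k ω} (fun ω => (1 - ρ) * noChange ρ ℓ X k n ω)
      (measurable_id'' (h.pastSigma_le k n)) (h.measurable_X _ _)
      (h.measurable_t k measurableSet_Ioi) (hmeas.const_mul _) hℓ ?_ ?_ ?_ ?_ ?_
  · have := measure_univ (μ := ν.withDensity f₁)
    rwa [← hℓf, withDensity_apply _ .univ, Measure.restrict_univ] at this
  · intro ω
    have := noChange_mem hρ ℓ (X := X) k n ω
    exact ⟨mul_pos h1 this.1, by nlinarith [this.1, this.2, hρ.1]⟩
  · intro A B hA hB
    exact h.measure_inter_obs hρ hA hB (V := Set.Ioi (n + 1)) fun m hm => if_pos hm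
  · intro A B hA hB
    rw [hℓf]
    exact h.measure_inter_obs hρ hA hB (V := (Set.Ioi (n + 1))ᶜ) fun m hm => if_neg hm
  · intro A hA
    simp only [Set.preimage_id, id]
    rw [h.measure_inter_lt_succ hρ hA, hprob A hA, ← lintegral_const_mul]
    · simp_rw [ENNReal.ofReal_mul h1.le]
    · exact (hmeas.mono (h.pastSigma_le k n) le_rfl).ennreal_ofReal

theorem noChange_spec (h : IsModel μ ν f₀ f₁ ρ t X) (hρ : ρ ∈ Set.Ioo (0 : ℝ) 1)
    [IsProbabilityMeasure (ν.withDensity f₀)] [IsProbabilityMeasure (ν.withDensity f₁)]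
    (hℓ : Measurable ℓ) (hℓf : (ν.withDensity f₀).withDensity ℓ = ν.withDensity f₁) (k : Fin K)
    (n : ℕ) : Measurable[pastSigma t X k n] (noChange ρ ℓ X k n) ∧
      ∀ A, MeasurableSet[pastSigma t X k n] A →
        μ (A ∩ {ω | n < t k ω}) = ∫⁻ ω in A, ENNReal.ofReal (noChange ρ ℓ X k n ω) ∂μ := by
  induction n with
  | zero =>
    refine ⟨measurable_const, fun A hA => ?_⟩
    simp only [noChange, ENNReal.ofReal_one, lintegral_one, Measure.restrict_apply_univ]
    refine measure_inter_conull ?_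
    have : {ω | 0 < t k ω}ᶜ = {ω | t k ω = 0} := by ext; simp
    rw [this]
    exact h.measure_eq_zero hρ k
  | succ n ih =>
    have hst := h.isStep hρ hℓ hℓf ih.1 ih.2
    have hv : Measurable[pastSigma t X k n] (noChange ρ ℓ X k n) := ih.1
    refine ⟨?_, fun A hA => ?_⟩
    · have h1 : Measurable[pastSigma t X k (n + 1)] fun ω => ℓ (X (n + 1) k ω) := by
        refine hℓ.comp fun B hB => measurableSet_pastSigma_data (by simp) hB
      have h2 := hv.mono (pastSigma_mono t X k n.le_succ) le_rfl
      change Measurable[pastSigma t X k (n + 1)] fun ω =>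
        (1 - ρ) * noChange ρ ℓ X k n ω / ((1 - (1 - ρ) * noChange ρ ℓ X k n ω) *
          (ℓ (X (n + 1) k ω)).toReal + (1 - ρ) * noChange ρ ℓ X k n ω)
      exact (h2.const_mul _).div ((((h2.const_mul _).const_sub _).mul h1.ennreal_toReal).add
        (h2.const_mul _))
    · obtain ⟨A', hA', rfl⟩ := pastSigma_succ_le k n A hA
      exact @IsStep.prob_bayes Ω Ω E _ (pastSigma t X k n) _ μ _ (ν.withDensity f₀) _ ℓ _ _ _ _
        hst A' hA'

/-- The prediction factor `1 - ρ` contributes `-log (1 - ρ)`, and the Bayes update at most the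
divergence. -/
theorem lintegral_neg_log_noChange_le (h : IsModel μ ν f₀ f₁ ρ t X) (hρ : ρ ∈ Set.Ioo (0 : ℝ) 1)
    [IsProbabilityMeasure (ν.withDensity f₀)] [IsProbabilityMeasure (ν.withDensity f₁)]
    (hℓ : Measurable ℓ) (hℓf : (ν.withDensity f₀).withDensity ℓ = ν.withDensity f₁) (k : Fin K)
    (n : ℕ) {A : Set Ω} (hA : MeasurableSet[pastSigma t X k n] A) :
    ∫⁻ ω in A, ENNReal.ofReal (-Real.log (noChange ρ ℓ X k (n + 1) ω)) ∂μ ≤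
      ∫⁻ ω in A, ENNReal.ofReal (-Real.log (noChange ρ ℓ X k n ω)) ∂μ +
        (∫⁻ e, ENNReal.ofReal (klFun (ℓ e).toReal) ∂ν.withDensity f₀ +
          ENNReal.ofReal (-Real.log (1 - ρ))) * μ A := by
  obtain ⟨h1, h2⟩ := h.noChange_spec hρ hℓ hℓf k n
  have hst := h.isStep hρ hℓ hℓf h1 h2
  have hρ' : 0 < 1 - ρ := by linarith [hρ.2]
  refine (@IsStep.lintegral_neg_log_bayes_le Ω Ω E _ (pastSigma t X k n) _ μ _
    (ν.withDensity f₀) _ ℓ _ _ _ _ hst A hA).trans_eq ?_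
  have hlog : ∀ ω, ENNReal.ofReal (-Real.log ((1 - ρ) * noChange ρ ℓ X k n ω)) =
      ENNReal.ofReal (-Real.log (noChange ρ ℓ X k n ω)) + ENNReal.ofReal (-Real.log (1 - ρ)) := by
    intro ω
    have := noChange_mem hρ ℓ (X := X) k n ω
    rw [Real.log_mul hρ'.ne' this.1.ne', ← ENNReal.ofReal_add]
    · congr 1; ring
    · linarith [Real.log_nonpos this.1.le this.2]
    · linarith [Real.log_nonpos hρ'.le (by linarith [hρ.1])]
  simp only [Set.preimage_id, id, hlog]
  rw [lintegral_add_right _ measurable_const, setLIntegral_const]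
  ring

end IsModel

end ChangePoint

namespace ChangePoint

/-! ### Declaration rules and active sets. -/

section Rules

variable {K : ℕ}

/-- A declaration rule that declares every active stream whose posterior probability is at least
`1 - a`, and only streams whose posterior probability is at least `1 - b`. -/
structure IsThresholdRule (declare : Finset (Fin K) → (Fin K → ℝ) → Finset (Fin K)) (a b : ℝ) :
    Prop where
  measurable : ∀ I k, MeasurableSet {p : Fin K → ℝ | k ∈ declare I p}
  mem_of_le : ∀ I p k, k ∈ I → 1 - a ≤ p k → k ∈ declare I p
  le_of_mem : ∀ I p k, k ∈ declare I p → 1 - b ≤ p k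

theorem isThresholdRule_ismapDeclare (α : ℝ) :
    IsThresholdRule (ismapDeclare (K := K) α) α α where
  measurable I k := by
    by_cases hk : k ∈ I
    · have : Measurable fun p : Fin K → ℝ => p k := measurable_pi_apply k
      simp only [ismapDeclare, Finset.mem_filter, hk, true_and]
      exact measurableSet_le measurable_const this
    · simp [ismapDeclare, hk]
  mem_of_le I p k hk h := Finset.mem_filter.2 ⟨hk, h⟩
  le_of_mem I p k h := (Finset.mem_filter.1 h).2

theorem measurable_rank (I : Finset (Fin K)) (k : Fin K) :
    Measurable fun p : Fin K → ℝ => rank I p k := by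
  simp only [rank, Finset.card_filter]
  refine Finset.measurable_sum _ fun j _ => Measurable.ite ?_ measurable_const measurable_const
  have h1 : Measurable fun p : Fin K → ℝ => p j := measurable_pi_apply j
  have h2 : Measurable fun p : Fin K → ℝ => p k := measurable_pi_apply k
  exact (measurableSet_lt h1 h2).union ((measurableSet_eq_fun h1 h2).inter (.const _))

theorem rank_lt_rank {I : Finset (Fin K)} {p : Fin K → ℝ} {j k : Fin K} (hj : j ∈ I)
    (h : p k < p j) : rank I p k < rank I p j := by
  refine Finset.card_lt_card ⟨fun i hi => ?_, fun hsub => ?_⟩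
  · obtain ⟨hi, h'⟩ := Finset.mem_filter.1 hi
    refine Finset.mem_filter.2 ⟨hi, Or.inl ?_⟩
    rcases h' with h' | h'
    exacts [h'.trans h, h'.1.trans_lt h]
  · have := (Finset.mem_filter.1 (hsub (Finset.mem_filter.2 ⟨hj, Or.inr ⟨rfl, le_rfl⟩⟩))).2
    rcases this with h' | h'
    exacts [h'.not_gt h, h.ne' h'.1]

/-- The index `K - l + 1` runs within `1, …, K`, so each threshold lies between `1 - α` and `1 - α /
K`. A stream above the largest threshold is its own witness; a declared stream has a posterior at
least that of its witness, as ranks are ordered by posterior. -/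
theorem isThresholdRule_smapDeclare {α : ℝ} (hα : 0 < α) :
    IsThresholdRule (smapDeclare (K := K) α) (α / K) α where
  measurable I k := by
    by_cases hk : k ∈ I
    · have : {p : Fin K → ℝ | k ∈ smapDeclare α I p} = ⋃ j ∈ I,
          {p | smapThreshold K α (K - rank I p j + 1) ≤ p j} ∩ {p | rank I p j ≤ rank I p k} := by
        ext p
        simp only [smapDeclare, Finset.mem_filter, Set.mem_ofPred_eq, hk, true_and, Set.mem_iUnion,
          Set.mem_inter_iff, exists_prop]
      rw [this]
      refine Finset.measurableSet_biUnion _ fun j _ => ?_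
      have h1 : Measurable fun p : Fin K → ℝ => smapThreshold K α (K - rank I p j + 1) :=
        (measurable_of_countable fun r : ℕ => smapThreshold K α (K - r + 1)).comp
          (measurable_rank I j)
      exact (measurableSet_le h1 (measurable_pi_apply j)).inter
        (measurableSet_le (measurable_rank I j) (measurable_rank I k))
    · simp [smapDeclare, hk]
  mem_of_le I p k hk h := by
    refine Finset.mem_filter.2 ⟨hk, k, hk, le_trans ?_ h, le_rfl⟩
    have h1 : (1 : ℝ) ≤ ((K - rank I p k + 1 : ℕ) : ℝ) := by exact_mod_cast Nat.le_add_left 1 _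
    have h2 : 1 * (α / K) ≤ ((K - rank I p k + 1 : ℕ) : ℝ) * (α / K) := by gcongr
    rw [smapThreshold, mul_div_assoc]
    linarith
  le_of_mem I p k h := by
    obtain ⟨hk, j, hj, h1, h2⟩ := Finset.mem_filter.1 h
    have hjk : p j ≤ p k := by
      by_contra! hlt
      exact (rank_lt_rank hj hlt).not_ge h2
    refine le_trans ?_ (h1.trans hjk)
    have hK : 0 < K := k.pos
    have hpos : 0 < rank I p j :=
      Finset.card_pos.2 ⟨j, Finset.mem_filter.2 ⟨hj, Or.inr ⟨rfl, le_rfl⟩⟩⟩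
    have h3 : ((K - rank I p j + 1 : ℕ) : ℝ) ≤ K := by
      exact_mod_cast show K - rank I p j + 1 ≤ K by omega
    have h4 : ((K - rank I p j + 1 : ℕ) : ℝ) * α / K ≤ α := by
      rw [div_le_iff₀ (by exact_mod_cast hK), mul_comm α]
      gcongr
    rw [smapThreshold]
    linarith

variable {declare : Finset (Fin K) → (Fin K → ℝ) → Finset (Fin K)}

theorem mem_active_succ {p : ℕ → Fin K → ℝ} {n : ℕ} {k : Fin K} :
    k ∈ active declare p (n + 1) ↔
      k ∈ active declare p n ∧ k ∉ declare (active declare p n) (p (n + 1)) :=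
  Finset.mem_sdiff

theorem active_antitone (p : ℕ → Fin K → ℝ) : Antitone (active declare p) :=
  antitone_nat_of_succ_le fun _ => Finset.sdiff_subset

/-- The active sets decrease and the count starts at `n = 0`, so the number of times at which `k` is
active is the declaration time itself, also when it is `⊤`. -/
theorem toENNReal_stopTime (p : ℕ → Fin K → ℝ) (k : Fin K) :
    ((stopTime declare p k : ℕ∞) : ℝ≥0∞) =
      ∑' n, if k ∈ active declare p n then (1 : ℝ≥0∞) else 0 := by
  classical
  by_cases h : ∃ n, k ∉ active declare p n
  · have hmem : ∀ n, k ∈ active declare p n ↔ n < Nat.find h := fun n => by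
      refine ⟨fun hn => ?_, fun hn => not_not.1 (Nat.find_min h hn)⟩
      by_contra! hle
      exact Nat.find_spec h (active_antitone p hle hn)
    have hT : stopTime declare p k = (Nat.find h : ℕ) :=
      le_antisymm (iInf₂_le (Nat.find h) (Nat.find_spec h))
        (le_iInf₂ fun n hn => Nat.cast_le.2 (Nat.find_min' h hn))
    rw [hT, tsum_eq_sum (s := Finset.range (Nat.find h)) fun n hn => if_neg (by
      rw [hmem]; simpa using hn), Finset.sum_congr rfl fun n hn => if_pos ((hmem n).2 (by
      simpa using hn))]
    simp
  · push Not at h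
    have hT : stopTime declare p k = ⊤ := by simp [stopTime, h]
    simp [hT, h]

theorem IsThresholdRule.measurableSet_active {Ω : Type*} {a b : ℝ}
    (hd : IsThresholdRule declare a b) {ℱ : ℕ → MeasurableSpace Ω} (hℱ : Monotone ℱ)
    {p : ℕ → Fin K → Ω → ℝ} (hp : ∀ n k, Measurable[ℱ n] (p n k)) (n : ℕ) (k : Fin K) :
    MeasurableSet[ℱ n] {ω | k ∈ active declare (fun m j => p m j ω) n} := by
  have hU : ∀ n, (∀ k, MeasurableSet[ℱ n] {ω | k ∈ active declare (fun m j => p m j ω) n}) →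
      ∀ I, MeasurableSet[ℱ n] {ω | active declare (fun m j => p m j ω) n = I} := by
    intro n hn I
    have : {ω | active declare (fun m j => p m j ω) n = I} =
        ⋂ k, {ω | k ∈ active declare (fun m j => p m j ω) n ↔ k ∈ I} := by
      ext ω
      simp [Finset.ext_iff]
    rw [this]
    refine MeasurableSet.iInter fun k => ?_
    by_cases hk : k ∈ I
    · simpa [hk] using hn k
    · have := (hn k).compl
      simp only [hk, iff_false]
      exact this
  induction n generalizing k with
  | zero => simp [active]
  | succ n ih =>
    have : {ω | k ∈ active declare (fun m j => p m j ω) (n + 1)} =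
        {ω | k ∈ active declare (fun m j => p m j ω) n} ∩
        ⋃ I : Finset (Fin K), {ω | active declare (fun m j => p m j ω) n = I} ∩
          (fun ω j => p (n + 1) j ω) ⁻¹' {q | k ∈ declare I q}ᶜ := by
      ext ω
      simp [mem_active_succ]
    rw [this]
    refine (hℱ n.le_succ _ (ih k)).inter (MeasurableSet.iUnion fun I => ?_)
    have hvec : Measurable[ℱ (n + 1)] fun ω j => p (n + 1) j ω :=
      @measurable_pi_lambda Ω (Fin K) (fun _ => ℝ) (ℱ (n + 1)) _ _ fun j => hp (n + 1) j
    exact (hℱ n.le_succ _ (hU n ih I)).inter (hvec (hd.measurable I k).compl)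

end Rules

/-! ### Posterior probabilities from the observed data, and bounds for the mean declaration time. -/

section Posterior

variable {Ω E : Type*} {K : ℕ} [mΩ : MeasurableSpace Ω] [MeasurableSpace E] {μ : Measure Ω}
  [IsProbabilityMeasure μ] {ν : Measure E} {f₀ f₁ : E → ℝ≥0∞} {ρ : ℝ}
  {t : Fin K → Ω → ℕ} {X : ℕ → Fin K → Ω → E} {s : ℕ → Ω → Finset (Fin K)}

/-- The conditional probability that the stream `k` has not changed up to time `n`, given the data
observed up to time `n`. -/
noncomputable def survival (μ : Measure Ω) (t : Fin K → Ω → ℕ) (X : ℕ → Fin K → Ω → E)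
    (s : ℕ → Ω → Finset (Fin K)) (k : Fin K) (n : ℕ) (ω : Ω) : ℝ :=
  1 - (μ[({ω | t k ω ≤ n}.indicator fun _ => (1 : ℝ)) | obsSigma X s n]) ω

omit [IsProbabilityMeasure μ] in
theorem stronglyMeasurable_survival (k : Fin K) (n : ℕ) :
    StronglyMeasurable[obsSigma X s n] (survival μ t X s k n) :=
  stronglyMeasurable_const.sub stronglyMeasurable_condExp

theorem IsModel.integrable_indicator_le (h : IsModel μ ν f₀ f₁ ρ t X) (k : Fin K) (n : ℕ) :
    Integrable ({ω | t k ω ≤ n}.indicator fun _ => (1 : ℝ)) μ :=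
  (integrable_const 1).indicator (h.measurable_t k measurableSet_Iic)

theorem integrable_survival (k : Fin K) (n : ℕ) :
    Integrable (survival μ t X s k n) μ :=
  (integrable_const 1).sub integrable_condExp

theorem IsModel.survival_mem (h : IsModel μ ν f₀ f₁ ρ t X) {n : ℕ} (hle : obsSigma X s n ≤ mΩ)
    (k : Fin K) : ∀ᵐ ω ∂μ, survival μ t X s k n ω ∈ Set.Icc (0 : ℝ) 1 := by
  have h0 : 0 ≤ᵐ[μ] μ[({ω | t k ω ≤ n}.indicator fun _ => (1 : ℝ)) | obsSigma X s n] :=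
    condExp_nonneg (ae_of_all _ fun ω => Set.indicator_nonneg (fun _ _ => zero_le_one) ω)
  have h1 : μ[({ω | t k ω ≤ n}.indicator fun _ => (1 : ℝ)) | obsSigma X s n] ≤ᵐ[μ]
      μ[(fun _ => (1 : ℝ)) | obsSigma X s n] :=
    condExp_mono (h.integrable_indicator_le k n) (integrable_const 1)
      (ae_of_all _ fun ω => Set.indicator_le_self' (fun _ _ => zero_le_one) ω)
  rw [condExp_const hle] at h1
  filter_upwards [h0, h1] with ω h0 h1
  simp only [Pi.zero_apply] at h0
  constructor <;> simp only [survival] <;> linarith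

theorem IsModel.setIntegral_survival (h : IsModel μ ν f₀ f₁ ρ t X) {n : ℕ}
    (hle : obsSigma X s n ≤ mΩ) (k : Fin K) {S : Set Ω} (hS : MeasurableSet[obsSigma X s n] S) :
    ∫ ω in S, survival μ t X s k n ω ∂μ = μ.real (S ∩ {ω | n < t k ω}) := by
  have hm : MeasurableSet {ω | t k ω ≤ n} := h.measurable_t k measurableSet_Iic
  have h1 : ∫ ω in S, survival μ t X s k n ω ∂μ =
      μ.real S - μ.real (S ∩ {ω | t k ω ≤ n}) := by
    simp only [survival]
    rw [integral_sub (integrable_const _) integrable_condExp.integrableOn,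
      setIntegral_condExp hle (h.integrable_indicator_le k n) hS, setIntegral_indicator hm]
    simp
  have h2 := measureReal_inter_add_sdiff (μ := μ) (s := S) hm
  have h3 : S \ {ω | t k ω ≤ n} = S ∩ {ω | n < t k ω} := by ext; simp
  rw [h3] at h2
  linarith

theorem IsModel.condExp_survival (h : IsModel μ ν f₀ f₁ ρ t X) (hρ : ρ ∈ Set.Ioo (0 : ℝ) 1)
    {k : Fin K} (hle : ∀ n, obsSigma X s n ≤ pastSigma t X k n) (n : ℕ) :
    μ[survival μ t X s k (n + 1) | obsSigma X s n] =ᵐ[μ]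
      fun ω => (1 - ρ) * survival μ t X s k n ω := by
  have hle' : ∀ n, obsSigma X s n ≤ mΩ := fun n => (hle n).trans (h.pastSigma_le k n)
  symm
  refine ae_eq_condExp_of_forall_setIntegral_eq (hle' n) (integrable_survival k _)
    (fun S _ _ => ((integrable_survival k _).const_mul _).integrableOn) (fun S hS _ => ?_)
    ((stronglyMeasurable_survival k n).const_mul _).aestronglyMeasurable
  rw [integral_const_mul, h.setIntegral_survival (hle' n) k hS,
    h.setIntegral_survival (hle' _) k (obsSigma_mono s n.le_succ _ hS)]
  simp only [Measure.real]
  rw [h.measure_inter_lt_succ hρ (hle n _ hS), ENNReal.toReal_mul,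
    ENNReal.toReal_ofReal (by linarith [hρ.2])]

theorem IsModel.survival_zero (h : IsModel μ ν f₀ f₁ ρ t X) (hρ : ρ ∈ Set.Ioo (0 : ℝ) 1)
    (k : Fin K) : ∀ᵐ ω ∂μ, survival μ t X s k 0 ω = 1 := by
  have h0 : ({ω | t k ω ≤ 0}.indicator fun _ => (1 : ℝ)) =ᵐ[μ] (0 : Ω → ℝ) := by
    filter_upwards [measure_eq_zero_iff_ae_notMem.1 (h.measure_eq_zero hρ k)] with ω hω
    exact Set.indicator_of_notMem (s := {ω | t k ω ≤ 0})
      (fun h : t k ω ≤ 0 => hω (Nat.le_zero.1 h)) _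
  have h1 : μ[({ω | t k ω ≤ 0}.indicator fun _ => (1 : ℝ)) | obsSigma X s 0] =ᵐ[μ] 0 := by
    simpa using condExp_congr_ae (m := obsSigma X s 0) h0
  filter_upwards [h1] with ω hω
  rw [survival, hω, Pi.zero_apply, sub_zero]

variable {q a b : ℝ} {declare : Finset (Fin K) → (Fin K → ℝ) → Finset (Fin K)}
  {π : ℕ → Fin K → Ω → ℝ}

/-- The event that the stream `k` is active after time slot `n`, for the procedure that uses exactly
the conditional probabilities `survival`. -/
def activeSet (μ : Measure Ω) (t : Fin K → Ω → ℕ) (X : ℕ → Fin K → Ω → E)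
    (s : ℕ → Ω → Finset (Fin K)) (declare : Finset (Fin K) → (Fin K → ℝ) → Finset (Fin K))
    (k : Fin K) (n : ℕ) : Set Ω :=
  {ω | k ∈ active declare (fun m j => 1 - survival μ t X s j m ω) n}

omit [IsProbabilityMeasure μ] in
theorem IsThresholdRule.measurableSet_activeSet (hd : IsThresholdRule declare a b) (k : Fin K)
    (n : ℕ) : MeasurableSet[obsSigma X s n] (activeSet μ t X s declare k n) :=
  hd.measurableSet_active (obsSigma_mono s)
    (p := fun m j ω => 1 - survival μ t X s j m ω)
    (fun m j => measurable_const.sub (stronglyMeasurable_survival j m).measurable) n k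

omit [IsProbabilityMeasure μ] in
theorem activeSet_succ_subset (k : Fin K) (n : ℕ) :
    activeSet μ t X s declare k (n + 1) ⊆ activeSet μ t X s declare k n :=
  fun _ h => (mem_active_succ.1 h).1

omit [IsProbabilityMeasure μ] in
theorem activeSet_zero (k : Fin K) : activeSet μ t X s declare k 0 = Set.univ := by
  ext ω
  simp [activeSet, active]

omit [IsProbabilityMeasure μ] in
theorem IsThresholdRule.le_survival (hd : IsThresholdRule declare a b) {k : Fin K} {n : ℕ} {ω : Ω}
    (h : ω ∈ activeSet μ t X s declare k (n + 1)) : a ≤ survival μ t X s k (n + 1) ω := by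
  obtain ⟨h1, h2⟩ := mem_active_succ.1 h
  by_contra! hlt
  exact h2 (hd.mem_of_le _ _ _ h1 (by linarith))

omit [IsProbabilityMeasure μ] in
theorem IsThresholdRule.survival_le (hd : IsThresholdRule declare a b) {k : Fin K} {n : ℕ} {ω : Ω}
    (h : ω ∈ activeSet μ t X s declare k n \ activeSet μ t X s declare k (n + 1)) :
    survival μ t X s k (n + 1) ω ≤ b := by
  have h2 : k ∈ declare (active declare (fun m j => 1 - survival μ t X s j m ω) n)
      fun j => 1 - survival μ t X s j (n + 1) ω := by
    by_contra h'
    exact h.2 (mem_active_succ.2 ⟨h.1, h'⟩)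
  have := hd.le_of_mem _ _ _ h2
  linarith

omit [IsProbabilityMeasure μ] in
-- Almost surely `π` agrees with `1 - survival` at all times and for all streams, so the procedure
-- can be replaced by the one defining `activeSet`, whose events are measurable for the observed
-- data.
theorem IsProcedure.lintegral_stopTime (hp : IsProcedure μ t X q declare s π)
    (hd : IsThresholdRule declare a b) {k : Fin K} (hle : ∀ n, obsSigma X s n ≤ mΩ) :
    ∫⁻ ω, ((stopTime declare (fun m j => π m j ω) k : ℕ∞) : ℝ≥0∞) ∂μ =
      ∑' n, μ (activeSet μ t X s declare k n) := by
  have hae : ∀ᵐ ω ∂μ, ∀ m j, π m j ω = 1 - survival μ t X s j m ω := by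
    refine ae_all_iff.2 fun m => ae_all_iff.2 fun j => ?_
    filter_upwards [hp.posterior m j] with ω h
    rw [h, survival, sub_sub_cancel]
  have hm : ∀ n, MeasurableSet (activeSet μ t X s declare k n) := fun n =>
    hle n _ (hd.measurableSet_activeSet k n)
  simp_rw [← lintegral_indicator_one (hm _)]
  rw [← lintegral_tsum fun n => (measurable_one.indicator (hm n)).aemeasurable]
  refine lintegral_congr_ae ?_
  filter_upwards [hae] with ω h
  simp_rw [h]
  classical
  rw [toENNReal_stopTime]
  refine tsum_congr fun n => ?_
  rw [Set.indicator_apply]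
  exact if_congr Iff.rfl rfl rfl

theorem IsModel.lintegral_stopTime_le (h : IsModel μ ν f₀ f₁ ρ t X) (hρ : ρ ∈ Set.Ioo (0 : ℝ) 1)
    (hp : IsProcedure μ t X q declare s π) (hd : IsThresholdRule declare a b)
    (ha : a ∈ Set.Ioc (0 : ℝ) 1) (k : Fin K) :
    ∫⁻ ω, ((stopTime declare (fun m j => π m j ω) k : ℕ∞) : ℝ≥0∞) ∂μ ≤
      ENNReal.ofReal ((1 - Real.log ((1 - ρ) * a)) / -Real.log (1 - ρ)) := by
  have hpast : ∀ n, obsSigma X s n ≤ pastSigma t X k n := obsSigma_le_pastSigma hp.predictable k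
  have hle : ∀ n, obsSigma X s n ≤ mΩ := fun n => (hpast n).trans (h.pastSigma_le k n)
  rw [hp.lintegral_stopTime hd hle]
  have hlog : 0 < -Real.log (1 - ρ) := by
    linarith [Real.log_neg (by linarith [hρ.2] : 0 < 1 - ρ) (by linarith [hρ.1])]
  refine ENNReal.tsum_le_of_sum_range_le fun N => ?_
  have key := sum_measureReal_le (μ := μ) hle (hd.measurableSet_activeSet (μ := μ) (t := t) k)
    (activeSet_succ_subset k) (fun n => stronglyMeasurable_survival k n)
    (fun n => h.survival_mem (hle n) k) hρ ha (h.condExp_survival hρ hpast) (fun n => ?_) N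
  · rw [← ENNReal.ofReal_toReal (ENNReal.sum_ne_top.2 fun n _ => measure_ne_top μ _)]
    refine ENNReal.ofReal_le_ofReal ?_
    rw [le_div_iff₀ hlog, mul_comm, ENNReal.toReal_sum fun n _ => measure_ne_top μ _]
    exact key
  -- At time `0` nothing has been tested yet, so `a ≤ x₀` comes from `x₀ = 1` instead of from the
  -- rule.
  · cases n with
    | zero =>
      filter_upwards [h.survival_zero (s := s) hρ k] with ω hω _
      rw [hω]
      exact ha.2
    | succ n => exact ae_of_all _ fun ω hω => hd.le_survival hω

theorem IsModel.le_lintegral_stopTime (h : IsModel μ ν f₀ f₁ ρ t X) (hρ : ρ ∈ Set.Ioo (0 : ℝ) 1)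
    [IsProbabilityMeasure (ν.withDensity f₀)] [IsProbabilityMeasure (ν.withDensity f₁)]
    (hac : ν.withDensity f₁ ≪ ν.withDensity f₀)
    (hp : IsProcedure μ t X q declare s π) (hd : IsThresholdRule declare a b)
    (hb : b ∈ Set.Ioc (0 : ℝ) 1) (k : Fin K) :
    ENNReal.ofReal (-Real.log b) ≤
      (InformationTheory.klDiv (ν.withDensity f₁) (ν.withDensity f₀) +
        ENNReal.ofReal (-Real.log (1 - ρ))) *
      ∫⁻ ω, ((stopTime declare (fun m j => π m j ω) k : ℕ∞) : ℝ≥0∞) ∂μ := by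
  have hpast : ∀ n, obsSigma X s n ≤ pastSigma t X k n := obsSigma_le_pastSigma hp.predictable k
  have hle : ∀ n, obsSigma X s n ≤ mΩ := fun n => (hpast n).trans (h.pastSigma_le k n)
  have hA : ∀ n, MeasurableSet[obsSigma X s n] (activeSet μ t X s declare k n) :=
    hd.measurableSet_activeSet k
  rw [hp.lintegral_stopTime hd hle, InformationTheory.klDiv_eq_lintegral_klFun_of_ac hac]
  set ℓ := (ν.withDensity f₁).rnDeriv (ν.withDensity f₀) with hℓdef
  have hℓ : Measurable ℓ := Measure.measurable_rnDeriv _ _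
  have hℓf : (ν.withDensity f₀).withDensity ℓ = ν.withDensity f₁ :=
    Measure.withDensity_rnDeriv_eq _ _ hac
  have hlog : 0 < -Real.log (1 - ρ) := by
    linarith [Real.log_neg (by linarith [hρ.2] : 0 < 1 - ρ) (by linarith [hρ.1])]
  refine le_mul_tsum_measure (z := fun n ω => ENNReal.ofReal (-Real.log (noChange ρ ℓ X k n ω)))
    (fun n => hle n _ (hA n)) (activeSet_zero k) (activeSet_succ_subset k)
    ENNReal.ofReal_ne_top (fun h0 => ?_) (fun ω => by simp [noChange])
    (fun n => h.lintegral_neg_log_noChange_le hρ hℓ hℓf k n (hpast n _ (hA n))) fun n => ?_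
  · have := (add_eq_zero.1 h0).2
    rw [ENNReal.ofReal_eq_zero] at this
    linarith
  obtain ⟨hym, hyp⟩ := h.noChange_spec hρ hℓ hℓf k (n + 1)
  set S := activeSet μ t X s declare k n \ activeSet μ t X s declare k (n + 1) with hSdef
  have hS : MeasurableSet[obsSigma X s (n + 1)] S :=
    (obsSigma_mono s n.le_succ _ (hA n)).diff (hA (n + 1))
  have hy : Measurable (noChange ρ ℓ X k (n + 1)) := hym.mono (h.pastSigma_le k _) le_rfl
  have hlog' : 0 ≤ -Real.log b := by linarith [Real.log_nonpos hb.1.le hb.2]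
  -- The exit event `S` is observable, so `noChange` and `survival` have the same integral over it,
  -- namely `μ (S ∩ {n + 1 < t k})`; the rule bounds the latter by `b`.
  have hmass : ∫⁻ ω in S, ENNReal.ofReal (noChange ρ ℓ X k (n + 1) ω) ∂μ ≤
      ENNReal.ofReal b * μ S := by
    rw [← hyp S (hpast _ _ hS), ← ofReal_measureReal (measure_ne_top _ _),
      ← h.setIntegral_survival (hle _) k hS, ← ofReal_measureReal (measure_ne_top μ S),
      ← ENNReal.ofReal_mul hb.1.le]
    refine ENNReal.ofReal_le_ofReal ?_
    calc _ ≤ ∫ ω in S, b ∂μ :=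
          setIntegral_mono_on (integrable_survival k _).integrableOn
            (integrableOn_const (measure_ne_top _ _)) (hle _ _ hS) fun ω hω => hd.survival_le hω
      _ = _ := by rw [setIntegral_const, smul_eq_mul, mul_comm]
  -- Jensen in tangent form, from `log u ≤ u - 1` at `u = y / b`. After integration over `S` the
  -- last term is at most `μ S` and cancels the `1`.
  have hpt : ∀ ω, ENNReal.ofReal (-Real.log b) + 1 ≤
      ENNReal.ofReal (-Real.log (noChange ρ ℓ X k (n + 1) ω)) +
        ENNReal.ofReal b⁻¹ * ENNReal.ofReal (noChange ρ ℓ X k (n + 1) ω) := by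
    intro ω
    have hmem := noChange_mem hρ ℓ (X := X) k (n + 1) ω
    set y := noChange ρ ℓ X k (n + 1) ω
    have hb0 := hb.1
    have hy0 := hmem.1
    have h1 := Real.log_le_sub_one_of_pos (x := b⁻¹ * y) (by positivity)
    rw [Real.log_mul (by positivity) (by positivity), Real.log_inv] at h1
    rw [← ENNReal.ofReal_mul (by positivity), ← ENNReal.ofReal_one,
      ← ENNReal.ofReal_add hlog' zero_le_one,
      ← ENNReal.ofReal_add (by linarith [Real.log_nonpos hy0.le hmem.2]) (by positivity)]
    exact ENNReal.ofReal_le_ofReal (by linarith)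
  have hint := lintegral_mono (μ := μ.restrict S) hpt
  rw [lintegral_const, Measure.restrict_apply_univ, lintegral_add_left (by fun_prop),
    lintegral_const_mul _ (by fun_prop), add_mul, one_mul] at hint
  have hfin : ENNReal.ofReal b⁻¹ * ∫⁻ ω in S, ENNReal.ofReal (noChange ρ ℓ X k (n + 1) ω) ∂μ ≤
      μ S := by
    calc _ ≤ ENNReal.ofReal b⁻¹ * (ENNReal.ofReal b * μ S) := by gcongr
      _ = μ S := by
        rw [← mul_assoc, ← ENNReal.ofReal_mul (inv_nonneg.2 hb.1.le), inv_mul_cancel₀ hb.1.ne',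
          ENNReal.ofReal_one, one_mul]
  exact (ENNReal.add_le_add_iff_right (measure_ne_top μ S)).1
    (hint.trans (add_le_add le_rfl hfin))

end Posterior

/-! ### From mean declaration times to the asymptotic average delay. -/

section Asymptotics

theorem tendsto_abs_log_nhdsGT_zero : Tendsto (fun α : ℝ => |Real.log α|) (𝓝[>] 0) atTop :=
  tendsto_abs_atBot_atTop.comp Real.tendsto_log_nhdsGT_zero

variable {Ω E : Type*} {K : ℕ} [mΩ : MeasurableSpace Ω] [MeasurableSpace E] {μ : Measure Ω}
  [IsProbabilityMeasure μ] {ν : Measure E} {f₀ f₁ : E → ℝ≥0∞} {ρ q : ℝ}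
  {t : Fin K → Ω → ℕ} {X : ℕ → Fin K → Ω → E}
  {declare : ℝ → Finset (Fin K) → (Fin K → ℝ) → Finset (Fin K)}

omit [IsProbabilityMeasure μ] in
theorem avgDelay_le {d : Finset (Fin K) → (Fin K → ℝ) → Finset (Fin K)}
    {π : ℕ → Fin K → Ω → ℝ} {B : ℝ≥0∞}
    (hB : ∀ k, ∫⁻ ω, ((stopTime d (fun m j => π m j ω) k : ℕ∞) : ℝ≥0∞) ∂μ ≤ B) :
    avgDelay μ t d π ≤ B := by
  refine ENNReal.div_le_of_le_mul' ?_
  calc _ ≤ ∑ _k : Fin K, B :=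
        Finset.sum_le_sum fun k _ => (lintegral_mono fun ω => tsub_le_self).trans (hB k)
    _ = K * B := by simp

omit [IsProbabilityMeasure μ] in
theorem IsModel.le_avgDelay (h : IsModel μ ν f₀ f₁ ρ t X) (hK : 0 < K)
    {d : Finset (Fin K) → (Fin K → ℝ) → Finset (Fin K)} {π : ℕ → Fin K → Ω → ℝ} {B e : ℝ≥0∞}
    (he : ∀ k, ∫⁻ ω, (t k ω : ℝ≥0∞) ∂μ ≤ e)
    (hB : ∀ k, B ≤ ∫⁻ ω, ((stopTime d (fun m j => π m j ω) k : ℕ∞) : ℝ≥0∞) ∂μ) :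
    B - e ≤ avgDelay μ t d π := by
  have hk : ∀ k, B - e ≤ ∫⁻ ω, ((stopTime d (fun m j => π m j ω) k : ℕ∞) : ℝ≥0∞)
      - (t k ω : ℝ≥0∞) ∂μ := by
    intro k
    have hm : Measurable fun ω => (t k ω : ℝ≥0∞) :=
      (measurable_of_countable fun n : ℕ => (n : ℝ≥0∞)).comp (h.measurable_t k)
    refine tsub_le_iff_right.2 ((hB k).trans ?_)
    calc _ ≤ ∫⁻ ω, (((stopTime d (fun m j => π m j ω) k : ℕ∞) : ℝ≥0∞) - (t k ω : ℝ≥0∞))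
            + (t k ω : ℝ≥0∞) ∂μ := lintegral_mono fun ω => le_tsub_add
      _ = _ := lintegral_add_right _ hm
      _ ≤ _ := add_le_add le_rfl (he k)
  rw [avgDelay, ENNReal.le_div_iff_mul_le (Or.inl (by exact_mod_cast hK.ne'))
    (Or.inl (ENNReal.natCast_ne_top K)), mul_comm]
  calc _ = ∑ _k : Fin K, (B - e) := by simp
    _ ≤ _ := Finset.sum_le_sum fun k _ => hk k

/-- The constant `C` is arbitrary: as `|log α| → ∞`, any bounded term in the numerator can be traded
for a change of `r`. -/
theorem IsModel.exists_avgDelay_le (h : IsModel μ ν f₀ f₁ ρ t X) (hρ : ρ ∈ Set.Ioo (0 : ℝ) 1)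
    {M : ℝ} (hM : 1 ≤ M) {b : ℝ → ℝ}
    (hd : ∀ α, 0 < α → IsThresholdRule (declare α) (α / M) (b α)) (C : ℝ) :
    ∃ r : ℝ → ℝ, Tendsto r (𝓝[>] 0) (𝓝 0) ∧ ∀ᶠ α in 𝓝[>] (0 : ℝ),
      ∀ (s : ℕ → Ω → Finset (Fin K)) (π : ℕ → Fin K → Ω → ℝ),
        IsProcedure μ t X q (declare α) s π →
        avgDelay μ t (declare α) π ≤
          ENNReal.ofReal ((C + |Real.log α|) / |Real.log (1 - ρ)| * (1 + r α)) := by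
  have hρ' : 0 < 1 - ρ := by linarith [hρ.2]
  have hlog : Real.log (1 - ρ) < 0 := Real.log_neg hρ' (by linarith [hρ.1])
  have htop : Tendsto (fun α : ℝ => C + |Real.log α|) (𝓝[>] 0) atTop :=
    tendsto_atTop_add_const_left _ _ tendsto_abs_log_nhdsGT_zero
  -- Chosen so that the right side equals the bound of `lintegral_stopTime_le` with `a = α / M`.
  refine ⟨fun α => (1 - Real.log (1 - ρ) + Real.log M - C) / (C + |Real.log α|),
    htop.const_div_atTop _, ?_⟩
  filter_upwards [htop.eventually_gt_atTop 0, self_mem_nhdsWithin,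
    nhdsWithin_le_nhds (Iio_mem_nhds (zero_lt_one' ℝ))] with α hpos hα0 hα1 s π hp
  have hα0 : 0 < α := hα0
  have hα1 : α < 1 := hα1
  have ha : α / M ∈ Set.Ioc (0 : ℝ) 1 :=
    ⟨by positivity, (div_le_one (by linarith)).2 (by linarith)⟩
  refine (avgDelay_le fun k => h.lintegral_stopTime_le hρ hp (hd α hα0) ha k).trans_eq ?_
  have hlα : |Real.log α| = -Real.log α := abs_of_neg (Real.log_neg hα0 hα1)
  rw [abs_of_neg hlog, Real.log_mul hρ'.ne' ha.1.ne', Real.log_div hα0.ne' (by linarith)]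
  rw [hlα] at hpos ⊢
  congr 1
  field_simp
  ring

theorem IsModel.exists_le_avgDelay (h : IsModel μ ν f₀ f₁ ρ t X) (hρ : ρ ∈ Set.Ioo (0 : ℝ) 1)
    [IsProbabilityMeasure (ν.withDensity f₀)] [IsProbabilityMeasure (ν.withDensity f₁)]
    (hK : 0 < K) {a : ℝ → ℝ} (hd : ∀ α, 0 < α → IsThresholdRule (declare α) (a α) α) :
    ∃ r : ℝ → ℝ, Tendsto r (𝓝[>] 0) (𝓝 0) ∧ ∀ᶠ α in 𝓝[>] (0 : ℝ),
      ∀ (s : ℕ → Ω → Finset (Fin K)) (π : ℕ → Fin K → Ω → ℝ),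
        IsProcedure μ t X q (declare α) s π →
        delayLower ν f₀ f₁ ρ α * ENNReal.ofReal (1 + r α) ≤ avgDelay μ t (declare α) π := by
  have hρ' : 0 < 1 - ρ := by linarith [hρ.2]
  have hlog : Real.log (1 - ρ) < 0 := Real.log_neg hρ' (by linarith [hρ.1])
  by_cases hD : InformationTheory.klDiv (ν.withDensity f₁) (ν.withDensity f₀) = ∞
  · refine ⟨fun _ => 0, tendsto_const_nhds, Eventually.of_forall fun α s π _ => ?_⟩
    simp [delayLower, hD]
  have hac := (InformationTheory.klDiv_ne_top_iff.1 hD).1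
  -- The sum serves as one finite bound for the mean change points of all streams.
  set e : ℝ≥0∞ := ∑ k, ∫⁻ ω, (t k ω : ℝ≥0∞) ∂μ with he
  have heT : e ≠ ∞ := ENNReal.sum_ne_top.2 fun k _ => h.lintegral_changePoint_ne_top hρ k
  set κ : ℝ≥0∞ := InformationTheory.klDiv (ν.withDensity f₁) (ν.withDensity f₀) +
    ENNReal.ofReal |Real.log (1 - ρ)| with hκ
  have hκT : κ ≠ ∞ := ENNReal.add_ne_top.2 ⟨hD, ENNReal.ofReal_ne_top⟩
  have hκ0 : 0 < κ :=
    (ENNReal.ofReal_pos.2 (abs_pos.2 hlog.ne)).trans_le le_add_self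
  have hκr : 0 < κ.toReal := ENNReal.toReal_pos hκ0.ne' hκT
  -- Chosen so that `(|log α| / κ) (1 + r α) = |log α| / κ - e`; where this is negative,
  -- `ENNReal.ofReal` and the truncated subtraction both give `0`.
  refine ⟨fun α => -(e.toReal * κ.toReal) / |Real.log α|,
    tendsto_abs_log_nhdsGT_zero.const_div_atTop _, ?_⟩
  filter_upwards [self_mem_nhdsWithin,
    nhdsWithin_le_nhds (Iio_mem_nhds (zero_lt_one' ℝ))] with α hα0 hα1 s π hp
  have hα0 : 0 < α := hα0
  have hα1 : α < 1 := hα1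
  have hlα : Real.log α < 0 := Real.log_neg hα0 hα1
  have hlα' : 0 < |Real.log α| := abs_pos.2 hlα.ne
  have hB : ∀ k, delayLower ν f₀ f₁ ρ α ≤
      ∫⁻ ω, ((stopTime (declare α) (fun m j => π m j ω) k : ℕ∞) : ℝ≥0∞) ∂μ := by
    intro k
    have := h.le_lintegral_stopTime hρ hac hp (hd α hα0) ⟨hα0, hα1.le⟩ k
    rw [← abs_of_neg hlog, ← abs_of_neg hlα] at this
    exact ENNReal.div_le_of_le_mul' this
  refine le_trans (le_of_eq ?_) (h.le_avgDelay hK (e := e) (fun k =>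
    Finset.single_le_sum (f := fun k => ∫⁻ ω, (t k ω : ℝ≥0∞) ∂μ) (fun _ _ => zero_le)
      (Finset.mem_univ k)) hB)
  have hL : delayLower ν f₀ f₁ ρ α = ENNReal.ofReal (|Real.log α| / κ.toReal) := by
    rw [ENNReal.ofReal_div_of_pos hκr, ENNReal.ofReal_toReal hκT, delayLower]
  rw [hL, ← ENNReal.ofReal_mul (by positivity), ← ENNReal.ofReal_toReal heT,
    ← ENNReal.ofReal_sub _ ENNReal.toReal_nonneg, ENNReal.toReal_ofReal ENNReal.toReal_nonneg]
  congr 1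
  field_simp
  ring

end Asymptotics

end ChangePoint

theorem theorem3 {Ω E : Type*} [MeasurableSpace Ω] [MeasurableSpace E]
    (μ : Measure Ω) [IsProbabilityMeasure μ] (ν : Measure E) [SigmaFinite ν]
    (f₀ f₁ : E → ℝ≥0∞) (hf₀ : Measurable f₀) (hf₁ : Measurable f₁)
    (hf₀_one : ∫⁻ x, f₀ x ∂ν = 1) (hf₁_one : ∫⁻ x, f₁ x ∂ν = 1)
    (K : ℕ) (hK : 0 < K) (ρ : ℝ) (hρ : ρ ∈ Set.Ioo (0 : ℝ) 1) (q : ℝ) (hq : q ∈ Set.Icc (0 : ℝ) 1)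
    (t : Fin K → Ω → ℕ) (X : ℕ → Fin K → Ω → E)
    (hmodel : ChangePoint.IsModel μ ν f₀ f₁ ρ t X) :
    (∃ r : ℝ → ℝ, Tendsto r (𝓝[>] 0) (𝓝 0) ∧ ∀ᶠ α in 𝓝[>] (0 : ℝ),
      ∀ (s : ℕ → Ω → Finset (Fin K)) (π : ℕ → Fin K → Ω → ℝ),
        ChangePoint.IsProcedure μ t X q (ChangePoint.smapDeclare α) s π →
        ChangePoint.delayLower ν f₀ f₁ ρ α * ENNReal.ofReal (1 + r α) ≤
          ChangePoint.avgDelay μ t (ChangePoint.smapDeclare α) π) ∧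
    (∃ r : ℝ → ℝ, Tendsto r (𝓝[>] 0) (𝓝 0) ∧ ∀ᶠ α in 𝓝[>] (0 : ℝ),
      ∀ (s : ℕ → Ω → Finset (Fin K)) (π : ℕ → Fin K → Ω → ℝ),
        ChangePoint.IsProcedure μ t X q (ChangePoint.smapDeclare α) s π →
        ChangePoint.avgDelay μ t (ChangePoint.smapDeclare α) π ≤
          ENNReal.ofReal ((Real.log K - 1 / (K : ℝ) * Real.log (Nat.factorial K : ℝ) + |Real.log α|)
            / |Real.log (1 - ρ)| * (1 + r α))) ∧
    (∃ r : ℝ → ℝ, Tendsto r (𝓝[>] 0) (𝓝 0) ∧ ∀ᶠ α in 𝓝[>] (0 : ℝ),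
      ∀ (s : ℕ → Ω → Finset (Fin K)) (π : ℕ → Fin K → Ω → ℝ),
        ChangePoint.IsProcedure μ t X q (ChangePoint.ismapDeclare α) s π →
        ChangePoint.delayLower ν f₀ f₁ ρ α * ENNReal.ofReal (1 + r α) ≤
          ChangePoint.avgDelay μ t (ChangePoint.ismapDeclare α) π) ∧
    (∃ r : ℝ → ℝ, Tendsto r (𝓝[>] 0) (𝓝 0) ∧ ∀ᶠ α in 𝓝[>] (0 : ℝ),
      ∀ (s : ℕ → Ω → Finset (Fin K)) (π : ℕ → Fin K → Ω → ℝ),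
        ChangePoint.IsProcedure μ t X q (ChangePoint.ismapDeclare α) s π →
        ChangePoint.avgDelay μ t (ChangePoint.ismapDeclare α) π ≤
          ENNReal.ofReal (|Real.log α| / |Real.log (1 - ρ)| * (1 + r α))) := by
  have : IsProbabilityMeasure (ν.withDensity f₀) :=
    ⟨by rw [withDensity_apply _ .univ, Measure.restrict_univ, hf₀_one]⟩
  have : IsProbabilityMeasure (ν.withDensity f₁) :=
    ⟨by rw [withDensity_apply _ .univ, Measure.restrict_univ, hf₁_one]⟩
  have hK' : (1 : ℝ) ≤ K := by exact_mod_cast hK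
  refine ⟨hmodel.exists_le_avgDelay hρ hK
      fun α hα => ChangePoint.isThresholdRule_smapDeclare hα,
    hmodel.exists_avgDelay_le hρ hK'
      (fun α hα => ChangePoint.isThresholdRule_smapDeclare hα) _,
    hmodel.exists_le_avgDelay hρ hK fun α _ => ChangePoint.isThresholdRule_ismapDeclare α, ?_⟩
  -- IS-MAP is the case `M = 1`, `C = 0`; S-MAP above takes `M = K`, with `C` read off from the
  -- goal.
  simpa using hmodel.exists_avgDelay_le (q := q) hρ le_rfl
    (fun α _ => by simpa using ChangePoint.isThresholdRule_ismapDeclare (K := K) α) 0
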